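/- Let $m_R,m_L\ge 0$ be integers, $m=m_R+m_L$, and $N\ge m$. For $1\le j\le m$ let $$\mathbb S^{N-j}=\{u\in\mathbb C^{N-j+1}:\ \|u\|=1,\ u_1\in\mathbb R\setminus\{0\},\ u\neq \mathbf e_1\}$$ be the unit sphere of $\mathbb C^{N-j+1}$ modulo phase (the phase being fixed, up to sign, by requiring the first coordinate to be real), a manifold of real dimension $2(N-j)$. Let $du$ be the unitarily invariant volume of unit vectors modulo phase, that is, the measure on $\mathbb S^{N-j}$ whose restriction to each of $\{u_1>0\}$, $\{u_1<0\}$ is the restriction of the image of $\frac1{2\pi}$ times the surface measure of the full unit sphere of $\mathbb C^{N-j+1}$ under $v\mapsto \pm\frac{\overline{v_1}}{|v_1|}v$, respectively (total mass $\pi^{N-j}/(N-j)!$ before $\mathbf e_1$ is removed). Let $$R_j(u)=I_{N-j+1}-2\,\frac{(\mathbf e_1-u)(\mathbf e_1-u)^*}{\|\mathbf e_1-u\|^2},\qquad u\in\mathbb S^{N-j}.$$ Put $\Omega_j=\mathbb C\times\mathbb S^{N-j}\times\mathbb C^{N-j}$ and define $\Phi_j^R,\Phi_j^L:\Omega_j\times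 M_{N-j}(\mathbb C)\to M_{N-j+1}(\mathbb C)$ by $$\Phi_j^R(\lambda_j,u,w_j,M)=R_j(u)\begin{pmatrix}\lambda_j&w_j^*\\0&M\end{pmatrix}R_j(u),\qquad \Phi_j^L(\lambda_j,v,w_j,M)=R_j(v)\begin{pmatrix}\lambda_j&0\\w_j&M\end{pmatrix}R_j(v).$$ Let $\Phi:\prod_{j=1}^m\Omega_j\times M_{N-m}(\mathbb C)\to M_N(\mathbb C)$ be the composition $$\Phi=\Phi_1^R\circ(\mathrm{Id}\times\Phi_2^R)\circ\cdots\circ(\mathrm{Id}\times\Phi_{m_R}^R)\circ(\mathrm{Id}\times\Phi_{m_R+1}^L)\circ\cdots\circ(\mathrm{Id}\times\Phi_m^L).$$ Equip the source with the product of Lebesgue measure in the $\lambda_j$, $w_j$ and $M^{(m)}\in M_{N-m}(\mathbb C)$ and of the measures $du$, and $M_N(\mathbb C)$ with Lebesgue measure. Then the Jacobian of $\Phi$ is $$J(\Phi)=|\Delta(\boldsymbol\lambda)|^2\prod_{j=1}^m\big|\det[\lambda_j-M^{(m)}]\big|^2,\qquad \Delta(\boldsymbol\lambda)=\prod_{1\le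 i<j\le m}(\lambda_j-\lambda_i),$$ that is, for every measurable $g\ge0$ on the source, $$\int g(p)\,J(\Phi)(p)\,dp=\int_{M_N(\mathbb C)}\ \sum_{p\in\Phi^{-1}(X)}g(p)\,dX .$$ In particular $\mathrm{vol}(\Phi(E))=\int_E J(\Phi)$ for every measurable $E$ on which $\Phi$ is injective. -/

import Mathlib

open MeasureTheory
open scoped ENNReal

noncomputable section

namespace EigenvectorChange

/-- The Euclidean norm of a vector of `ℂ^k` (the plain function space carries the sup norm). -/
def l2norm {k : ℕ} (v : Fin k → ℂ) : ℝ := Real.sqrt (∑ i, ‖v i‖ ^ 2)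

/-- The first standard basis vector of `ℂ^(k+1)`. -/
def e1 (k : ℕ) : Fin (k + 1) → ℂ := Pi.single 0 1

/-- Unit vectors of `ℂ^(k+1)`, taken modulo phase: the phase is fixed by requiring the first
coordinate to be real (and nonzero, so that the phase is determined up to sign). The vector `e1`,
at which the Householder reflection below would be `0/0`, is left out. -/
def sphereSet (k : ℕ) : Set (Fin (k + 1) → ℂ) :=
  {u | l2norm u = 1 ∧ (u 0).im = 0 ∧ u 0 ≠ 0 ∧ u ≠ e1 k}

/-- The phase-reduced unit sphere of `ℂ^(k+1)`, of real dimension `2 k`. -/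
def Sphere (k : ℕ) : Type := sphereSet k

instance (k : ℕ) : MeasurableSpace (Sphere k) :=
  inferInstanceAs (MeasurableSpace (sphereSet k))

/-- The unit multiple of `v` whose first coordinate is positive (if `v 0 ≠ 0`). -/
def phaseFix {k : ℕ} (v : Fin (k + 1) → ℂ) : Fin (k + 1) → ℂ :=
  (star (v 0) / (‖v 0‖ * l2norm v : ℂ)) • v

/-- The open Euclidean unit ball of `ℂ^k`. -/
def unitBall (k : ℕ) : Set (Fin k → ℂ) := {v | l2norm v < 1}

/-- The unitarily invariant volume `du` of unit vectors modulo phase. Radial projection of Lebesgue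
measure on the unit ball of `ℂ^(k+1)` is the uniform measure of the full sphere; it is carried to
each of the two representatives `± phaseFix v` modulo phase. The constant `(k+1)/π` gives the
Riemannian volume of the quotient metric on (unit sphere)/phase, that is, `1/(2π)` times the surface
measure of the full unit sphere, of total mass `π^k / k!` for either sign of the first
coordinate. -/
instance (k : ℕ) : MeasureSpace (Sphere k) where
  volume := Measure.comap (Subtype.val : Sphere k → (Fin (k + 1) → ℂ))
    (ENNReal.ofReal ((k + 1 : ℝ) / Real.pi) •
      (Measure.map phaseFix ((volume : Measure (Fin (k + 1) → ℂ)).restrict (unitBall (k + 1))) +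
        Measure.map (fun v => -phaseFix v)
          ((volume : Measure (Fin (k + 1) → ℂ)).restrict (unitBall (k + 1)))))

/-- Lebesgue measure on complex square matrices: the product over all the entries. -/
instance (k : ℕ) : MeasureSpace (Matrix (Fin k) (Fin k) ℂ) :=
  inferInstanceAs (MeasureSpace (Fin k → Fin k → ℂ))

/-- The Householder reflection `R(u) = I - 2 (e1 - u)(e1 - u)^* / ‖e1 - u‖^2`. -/
def householder {k : ℕ} (u : Sphere k) : Matrix (Fin (k + 1)) (Fin (k + 1)) ℂ :=
  1 - (2 / (l2norm (e1 k - u.1) : ℂ) ^ 2) •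
    Matrix.vecMulVec (e1 k - u.1) (star (e1 k - u.1))

/-- The block matrix with rows `(lam, w^*)` and `(0, M)`. -/
def blockR {k : ℕ} (lam : ℂ) (w : Fin k → ℂ) (M : Matrix (Fin k) (Fin k) ℂ) :
    Matrix (Fin (k + 1)) (Fin (k + 1)) ℂ :=
  Matrix.of (Fin.cons (Fin.cons lam (star w)) fun i => Fin.cons 0 (M i))

/-- The block matrix with rows `(lam, 0)` and `(w, M)`. -/
def blockL {k : ℕ} (lam : ℂ) (w : Fin k → ℂ) (M : Matrix (Fin k) (Fin k) ℂ) :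
    Matrix (Fin (k + 1)) (Fin (k + 1)) ℂ :=
  Matrix.of (Fin.cons (Fin.cons lam 0) fun i => Fin.cons (w i) (M i))

/-- One step for a right eigenvector. -/
def stepR {k : ℕ} (lam : ℂ) (u : Sphere k) (w : Fin k → ℂ) (M : Matrix (Fin k) (Fin k) ℂ) :
    Matrix (Fin (k + 1)) (Fin (k + 1)) ℂ :=
  householder u * blockR lam w M * householder u

/-- One step for a left eigenvector. -/
def stepL {k : ℕ} (lam : ℂ) (v : Sphere k) (w : Fin k → ℂ) (M : Matrix (Fin k) (Fin k) ℂ) :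
    Matrix (Fin (k + 1)) (Fin (k + 1)) ℂ :=
  householder v * blockL lam w M * householder v

/-- The source of the `m`-step change of variables, for matrices of final size `N = n + m`:
eigenvalues, phase-reduced unit vectors, vectors `w`, and the remaining matrix `M^(m)` of size `n`.
The data with index `i` belong to the step from size `n + i` to size `n + i + 1`; in the numbering
`j = 1, …, m` from the outermost step inwards this is the step `j = m - i`, for which
`n + i = N - j`. It carries the product of Lebesgue measures and the measures `du`. -/
abbrev Params (n m : ℕ) : Type :=
  (Fin m → ℂ) × ((i : Fin m) → Sphere (n + i)) × ((i : Fin m) → Fin (n + i) → ℂ) ×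
    Matrix (Fin n) (Fin n) ℂ

/-- The matrix `M^(m - i)` obtained from `M^(m)` by the `i` innermost steps; the `mL` innermost
steps are for left eigenvectors, all the others for right eigenvectors. -/
def stage {n m : ℕ} (mL : ℕ) (p : Params n m) :
    (i : ℕ) → i ≤ m → Matrix (Fin (n + i)) (Fin (n + i)) ℂ
  | 0, _ => p.2.2.2
  | i + 1, h =>
    if i < mL then
      stepL (p.1 ⟨i, h⟩) (p.2.1 ⟨i, h⟩) (p.2.2.1 ⟨i, h⟩) (stage mL p i (Nat.le_of_succ_le h))
    else
      stepR (p.1 ⟨i, h⟩) (p.2.1 ⟨i, h⟩) (p.2.2.1 ⟨i, h⟩) (stage mL p i (Nat.le_of_succ_le h))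

/-- The change of variables: the `mR` outermost steps are for right eigenvectors, the `mL` innermost
ones for left eigenvectors. -/
def Phi (n mR mL : ℕ) (p : Params n (mR + mL)) :
    Matrix (Fin (n + (mR + mL))) (Fin (n + (mR + mL))) ℂ :=
  stage mL p (mR + mL) le_rfl

/-- `J` is the Jacobian of `f` with respect to the volumes of `X` and `Y`: `dy = J(x) dx` under
`y = f(x)`, the points of `X` over the same `y` being summed up. In particular
`vol (f(E)) = ∫_E J` for each measurable `E` on which `f` is injective. -/
def IsJacobian {X Y : Type*} [MeasureSpace X] [MeasureSpace Y] (f : X → Y) (J : X → ℝ) : Prop :=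
  (∀ x, 0 ≤ J x) ∧ Measurable J ∧ ∀ g : X → ℝ≥0∞, Measurable g →
    ∫⁻ x, g x * ENNReal.ofReal (J x) = ∫⁻ y, ∑' x : f ⁻¹' {y}, g x

/-- The Vandermonde product `Δ(lam) = ∏_{i < j} (lam_j - lam_i)`. -/
def vandermondeProd {m : ℕ} (lam : Fin m → ℂ) : ℂ :=
  ∏ i, ∏ j ∈ Finset.Ioi i, (lam j - lam i)

end EigenvectorChange

end

/-!
The map is a composition of one-step maps, each carrying the data of the outer steps along as
parameters, so the Jacobian is a product of one-step Jacobians once these are stable under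
composition and under carrying parameters along. The notion `HasJac` (change of variables with fibre
sums, including their almost everywhere measurability) has both properties: `HasJac.comp` and
`HasJac.prodMap_id`.

For one step with a right eigenvector, use the affine coordinate `z` of the eigenvector, which is
then proportional to `(1, z)`. A matrix `X` with eigenpair `lam`, `(1, z)` is determined by `lam`,
`z` and its last `k` columns `K`, since its first column must be `lam (1, z) - K z`. Two facts give
the Jacobian.

* For fixed `u` and `lam`, the passage from `(w, M)` to `K` is affine, with linear part
  `[w^*; M] ↦ R [w^*; M] R₂₂`, where `R₂₂` is the lower right block of the reflection `R`. As
  `det R₂₂ = -u₀` and `R² = 1`, its real Jacobian is `|u₀|^(2(k+1))`. This is exactly the density of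
  the volume `du` in the coordinate `z`. Hence `du dw dM` becomes `dz dK`, with two points `±u`
  above each `z` (one above `z = 0`, as `e1` is left out). See `hasJac_chart` and
  `hasJac_conjColumns`.
* The map `(lam, z, K) ↦ (lam (1, z) - K z, K)` is polynomial, and the area formula
  `HasJac.of_hasFDerivAt` applies. Its complex Jacobian determinant is `det (lam - M)`, by a column
  operation and conjugation by the reflection (`det_affine_column`).

So one step has Jacobian `|det (lam - M)|²` (`hasJac_stepR`); left eigenvectors are reduced to right
ones by taking adjoints (`hasJac_stepL`). The characteristic polynomial of `M` at an intermediate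
step is that of `M^(m)` times the linear factors of the eigenvalues split off further inside
(`det_scalar_sub_stage`), which produces the Vandermonde product.
-/

set_option synthInstance.maxSize 4000

noncomputable section

namespace EigenvectorChange

/-! ### Fibre sums and Jacobians -/

/-- The sum of `g` over the fibre of `f` above `y`. -/
def fiberSum {A B : Type*} (f : A → B) (g : A → ℝ≥0∞) (y : B) : ℝ≥0∞ :=
  ∑' x : f ⁻¹' {y}, g x

theorem fiberSum_eq_tsum {A B : Type*} (f : A → B) (g : A → ℝ≥0∞) (y : B) :
    fiberSum f g y = ∑' x, (f ⁻¹' {y}).indicator g x :=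
  tsum_subtype _ _

theorem fiberSum_add {A B : Type*} (f : A → B) (g h : A → ℝ≥0∞) :
    fiberSum f (fun x => g x + h x) = fun y => fiberSum f g y + fiberSum f h y := by
  funext y; exact ENNReal.tsum_add

theorem fiberSum_tsum {A B : Type*} (f : A → B) (g : ℕ → A → ℝ≥0∞) :
    fiberSum f (fun x => ∑' n, g n x) = fun y => ∑' n, fiberSum f (g n) y := by
  funext y; exact ENNReal.tsum_comm

theorem fiberSum_iSup {A B : Type*} (f : A → B) {g : ℕ → A → ℝ≥0∞} (hg : Monotone g) :
    fiberSum f (fun x => ⨆ n, g n x) = fun y => ⨆ n, fiberSum f (g n) y := by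
  funext y
  let _ : MeasurableSpace (f ⁻¹' {y}) := ⊤
  have : MeasurableSingletonClass (f ⁻¹' {y}) := ⟨fun _ => trivial⟩
  unfold fiberSum
  simp_rw [← lintegral_count]
  exact lintegral_iSup (fun n => measurable_from_top) fun m n hmn x => hg hmn x.1

theorem indicator_iUnion_eq_tsum {A : Type*} {s : ℕ → Set A} (hs : Pairwise (Function.onFun Disjoint s))
    (g : A → ℝ≥0∞) (x : A) : (⋃ n, s n).indicator g x = ∑' n, (s n).indicator g x := by
  by_cases hx : ∃ n, x ∈ s n
  · obtain ⟨n, hn⟩ := hx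
    rw [Set.indicator_of_mem (Set.mem_iUnion.2 ⟨n, hn⟩), tsum_eq_single n]
    · rw [Set.indicator_of_mem hn]
    · intro m hm
      exact Set.indicator_of_notMem (fun hxm => Set.disjoint_left.1 (hs hm) hxm hn) g
  · rw [Set.indicator_of_notMem (by simpa using hx)]
    symm
    rw [ENNReal.tsum_eq_zero]
    exact fun n => Set.indicator_of_notMem (fun h => hx ⟨n, h⟩) g

/-- On a set where `f` is injective, the fibre sum is composition with the partial inverse. -/
theorem fiberSum_indicator_of_injOn {A B : Type*} {f : A → B} {s : Set A} (hf : Set.InjOn f s)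
    (g : A → ℝ≥0∞) :
    fiberSum f (s.indicator g) =
      Function.extend (fun x : s => f x) (fun x : s => g x) fun _ => 0 := by
  funext y
  rw [fiberSum_eq_tsum]
  have hinj : Function.Injective fun x : s => f x := fun a b hab => Subtype.ext (hf a.2 b.2 hab)
  by_cases hy : ∃ x : s, f x = y
  · obtain ⟨x, rfl⟩ := hy
    rw [hinj.extend_apply, tsum_eq_single x.1]
    · rw [Set.indicator_of_mem (by simp), Set.indicator_of_mem x.2]
    · intro x' hx'
      by_cases hs : x' ∈ s
      · exact Set.indicator_of_notMem (show x' ∉ f ⁻¹' {f x} from fun h => hx' (hf hs x.2 h)) _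
      · rw [Set.indicator_indicator]
        exact Set.indicator_of_notMem (fun h => hs h.2) _
  · rw [Function.extend_apply' _ _ _ hy, ENNReal.tsum_eq_zero]
    intro x
    rw [Set.indicator_indicator]
    exact Set.indicator_of_notMem (fun h => hy ⟨⟨x, h.2⟩, h.1⟩) g

/-- Fibres of a composition are disjoint unions of fibres. -/
theorem fiberSum_comp {A B C : Type*} (f₁ : B → C) (f₂ : A → B) (g : A → ℝ≥0∞) :
    fiberSum (f₁ ∘ f₂) g = fiberSum f₁ (fiberSum f₂ g) := by
  funext y
  unfold fiberSum
  rw [← ENNReal.tsum_sigma (fun (b : f₁ ⁻¹' {y}) (x : f₂ ⁻¹' {b.1}) => g x)]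
  let e : (f₁ ∘ f₂ ⁻¹' {y}) ≃ Σ b : f₁ ⁻¹' {y}, f₂ ⁻¹' {b.1} :=
    { toFun := fun x => ⟨⟨f₂ x.1, x.2⟩, ⟨x.1, rfl⟩⟩
      invFun := fun s => ⟨s.2.1, by
        have h1 : f₂ s.2.1 = s.1.1 := s.2.2
        have h2 : f₁ s.1.1 = y := s.1.2
        simp [h1, h2]⟩
      left_inv := fun x => rfl
      right_inv := by
        rintro ⟨⟨b, hb⟩, ⟨x, hx⟩⟩
        obtain rfl : f₂ x = b := hx
        rfl }
  exact e.tsum_eq (fun s : Σ b : f₁ ⁻¹' {y}, f₂ ⁻¹' {b.1} => g s.2)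

theorem fiberSum_prodMap_id {A B Ω : Type*} (f : A → B) (g : A × Ω → ℝ≥0∞) (b : B) (w : Ω) :
    fiberSum (Prod.map f id) g (b, w) = fiberSum f (fun a => g (a, w)) b := by
  unfold fiberSum
  let e : (f ⁻¹' {b}) ≃ (Prod.map f (id : Ω → Ω) ⁻¹' {(b, w)}) :=
    { toFun := fun x => ⟨(x.1, w), by
        have : f x.1 = b := x.2
        simp [this]⟩
      invFun := fun s => ⟨s.1.1, congrArg Prod.fst s.2⟩
      left_inv := fun x => rfl
      right_inv := by
        rintro ⟨⟨a, w'⟩, h⟩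
        obtain rfl : w' = w := congrArg Prod.snd h
        rfl }
  exact (e.tsum_eq (fun s : (Prod.map f (id : Ω → Ω) ⁻¹' {(b, w)}) => g s)).symm

theorem fiberSum_of_inverse {A B : Type*} {f : A → B} {f' : B → A}
    (hl : Function.LeftInverse f' f) (hr : Function.RightInverse f' f) (g : A → ℝ≥0∞) (y : B) :
    fiberSum f g y = g (f' y) := by
  rw [fiberSum_eq_tsum, tsum_eq_single (f' y)]
  · rw [Set.indicator_of_mem]; exact hr y
  · intro x hx
    rw [Set.indicator_of_notMem]
    intro h
    obtain rfl : f x = y := h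
    exact hx (hl x).symm

/-- `f` has Jacobian `J`: the change of variables formula, with the points of each fibre summed up.
That fibre sums are almost everywhere measurable is part of the notion, which makes it stable under
composition. The Jacobian takes values in `ℝ≥0∞`. -/
structure HasJac {A B : Type*} [MeasureSpace A] [MeasureSpace B] (f : A → B) (J : A → ℝ≥0∞) :
    Prop where
  measurable : Measurable f
  measurable_jac : Measurable J
  aemeasurable_fiberSum : ∀ g : A → ℝ≥0∞, Measurable g → AEMeasurable (fiberSum f g) volume
  lintegral_eq : ∀ g : A → ℝ≥0∞, Measurable g → ∫⁻ x, g x * J x = ∫⁻ y, fiberSum f g y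

namespace HasJac

variable {A B C Ω : Type*} [MeasureSpace A] [MeasureSpace B] [MeasureSpace C] [MeasureSpace Ω]

theorem congr {f : A → B} {J J' : A → ℝ≥0∞} (h : HasJac f J) (hJ : ∀ x, J' x = J x) :
    HasJac f J' := by
  obtain rfl : J' = J := funext hJ
  exact h

/-- A bijection has only one-point fibres, so that only the change of variables is to be checked. -/
theorem of_inverse {f : A → B} {f' : B → A} (hl : Function.LeftInverse f' f)
    (hr : Function.RightInverse f' f) (hf : Measurable f) (hf' : Measurable f') {J : A → ℝ≥0∞}
    (hJ : Measurable J)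
    (h : ∀ g : A → ℝ≥0∞, Measurable g → ∫⁻ x, g x * J x = ∫⁻ y, g (f' y)) : HasJac f J where
  measurable := hf
  measurable_jac := hJ
  aemeasurable_fiberSum g hg := by
    simp_rw [funext (fiberSum_of_inverse hl hr g)]
    exact (hg.comp hf').aemeasurable
  lintegral_eq g hg := by
    simp_rw [fiberSum_of_inverse hl hr g]
    exact h g hg

theorem of_measurePreserving {f : A → B} {f' : B → A} (hl : Function.LeftInverse f' f)
    (hr : Function.RightInverse f' f) (hf' : Measurable f')
    (h : MeasurePreserving f) : HasJac f (fun _ => 1) := by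
  refine of_inverse hl hr h.measurable hf' measurable_const fun g hg => ?_
  have := h.lintegral_comp (hg.comp hf')
  simpa only [Function.comp, hl _, mul_one] using this

/-- Fibre sums are almost everywhere unaffected by a change of `g` on a null set, because almost no
fibre meets a given null set. -/
theorem ae_fiberSum_eq {f : A → B} {J : A → ℝ≥0∞} (h : HasJac f J) {g g' : A → ℝ≥0∞}
    (hg : g =ᵐ[volume] g') : fiberSum f g =ᵐ[volume] fiberSum f g' := by
  obtain ⟨N, hN, hNm, hN0⟩ := exists_measurable_superset_of_null hg
  have h1 : ∫⁻ y, fiberSum f (N.indicator 1) y = 0 := by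
    rw [← h.lintegral_eq _ (measurable_one.indicator hNm)]
    refine lintegral_eq_zero_of_ae_eq_zero ?_
    filter_upwards [compl_mem_ae_iff.2 hN0] with x hx
    rw [Set.indicator_of_notMem hx, zero_mul]; rfl
  rw [lintegral_eq_zero_iff' (h.aemeasurable_fiberSum _ (measurable_one.indicator hNm))] at h1
  filter_upwards [h1] with y hy
  unfold fiberSum at hy ⊢
  refine tsum_congr fun x => ?_
  have h2 : N.indicator (1 : A → ℝ≥0∞) x = 0 := ENNReal.tsum_eq_zero.1 hy x
  by_contra hne
  have : x.1 ∈ N := hN hne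
  simp [Set.indicator_of_mem this] at h2

theorem aemeasurable_fiberSum' {f : A → B} {J : A → ℝ≥0∞} (h : HasJac f J) {g : A → ℝ≥0∞}
    (hg : AEMeasurable g volume) : AEMeasurable (fiberSum f g) volume :=
  (h.aemeasurable_fiberSum _ hg.measurable_mk).congr (h.ae_fiberSum_eq hg.ae_eq_mk).symm

theorem lintegral_eq' {f : A → B} {J : A → ℝ≥0∞} (h : HasJac f J) {g : A → ℝ≥0∞}
    (hg : AEMeasurable g volume) : ∫⁻ x, g x * J x = ∫⁻ y, fiberSum f g y := by
  rw [lintegral_congr_ae (h.ae_fiberSum_eq hg.ae_eq_mk), ← h.lintegral_eq _ hg.measurable_mk]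
  refine lintegral_congr_ae ?_
  filter_upwards [hg.ae_eq_mk] with x hx
  rw [hx]

/-- The chain rule for Jacobians. -/
theorem comp {f₁ : B → C} {f₂ : A → B} {J₁ : B → ℝ≥0∞} {J₂ : A → ℝ≥0∞} (h₁ : HasJac f₁ J₁)
    (h₂ : HasJac f₂ J₂) : HasJac (f₁ ∘ f₂) (fun x => J₁ (f₂ x) * J₂ x) where
  measurable := h₁.measurable.comp h₂.measurable
  measurable_jac := (h₁.measurable_jac.comp h₂.measurable).mul h₂.measurable_jac
  aemeasurable_fiberSum g hg := by
    rw [fiberSum_comp]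
    exact h₁.aemeasurable_fiberSum' (h₂.aemeasurable_fiberSum g hg)
  lintegral_eq g hg := by
    rw [fiberSum_comp, ← h₁.lintegral_eq' (h₂.aemeasurable_fiberSum g hg)]
    have := h₂.lintegral_eq (fun x => g x * J₁ (f₂ x))
      (hg.mul (h₁.measurable_jac.comp h₂.measurable))
    simp_rw [← mul_assoc]
    rw [this]
    refine lintegral_congr fun y => ?_
    unfold fiberSum
    rw [← ENNReal.tsum_mul_right]
    refine tsum_congr fun x => ?_
    have : f₂ x = y := x.2
    simp only [this]

/-- A Jacobian is unaffected by a parameter that is carried along. Only the almost everywhere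
measurability of fibre sums needs an argument: the sets on which it holds form a λ-system, once the
source is cut into pieces with almost everywhere finite fibres. -/
theorem prodMap_id [SigmaFinite (volume : Measure A)] [SFinite (volume : Measure B)]
    [SFinite (volume : Measure Ω)] {f : A → B} {J : A → ℝ≥0∞} (h : HasJac f J)
    (hfin : ∀ x, J x ≠ ∞) :
    HasJac (Prod.map f (id : Ω → Ω)) (fun p => J p.1) := by
  -- finite measure and bounded Jacobian make the fibre sums finite almost everywhere
  have hcut : ∀ S : Set A, MeasurableSet S → volume S ≠ ∞ → ∀ c : ℕ, (∀ x ∈ S, J x ≤ c) →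
      ∀ᵐ y : B, fiberSum f (S.indicator 1) y ≠ ∞ := by
    intro S hS hSv c hc
    have h1 := h.lintegral_eq _ (measurable_one.indicator hS)
    have h2 : ∫⁻ x, S.indicator 1 x * J x ≤ c * volume S := by
      rw [← setLIntegral_const, ← lintegral_indicator hS]
      refine lintegral_mono fun x => ?_
      by_cases hx : x ∈ S
      · simpa [hx] using hc x hx
      · simp [hx]
    have h3 : ∫⁻ y, fiberSum f (S.indicator 1) y ≠ ∞ := by
      rw [← h1]
      exact ne_top_of_le_ne_top (ENNReal.mul_ne_top (by simp) hSv) h2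
    filter_upwards [ae_lt_top' (h.aemeasurable_fiberSum _ (measurable_one.indicator hS)) h3]
      with y hy using hy.ne
  let P : ℕ → Set A := fun n => spanningSets volume n ∩ {x | J x ≤ n}
  have hPm : ∀ n, MeasurableSet (P n) := fun n =>
    (measurableSet_spanningSets _ n).inter (measurableSet_le h.measurable_jac measurable_const)
  have hPU : ⋃ n, P n = Set.univ := by
    refine Set.eq_univ_of_forall fun x => ?_
    obtain ⟨n, hn⟩ := Set.mem_iUnion.1
      ((iUnion_spanningSets (volume : Measure A)).symm ▸ Set.mem_univ x)
    obtain ⟨c, hc⟩ := ENNReal.exists_nat_gt (hfin x)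
    refine Set.mem_iUnion.2 ⟨max n c, monotone_spanningSets _ (le_max_left _ _) hn, ?_⟩
    exact hc.le.trans (by exact_mod_cast le_max_right n c)
  let D : ℕ → Set A := disjointed P
  have hDm : ∀ n, MeasurableSet (D n) := fun n => MeasurableSet.disjointed hPm n
  have hDfin : ∀ n, ∀ᵐ y : B, fiberSum f ((D n).indicator 1) y ≠ ∞ := fun n =>
    hcut _ (hDm n) (ne_top_of_le_ne_top (measure_spanningSets_lt_top volume n).ne
      (measure_mono ((disjointed_subset P n).trans Set.inter_subset_left))) n
      fun x hx => (disjointed_subset P n hx).2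
  have hfs : ∀ g : A × Ω → ℝ≥0∞, fiberSum (Prod.map f (id : Ω → Ω)) g =
      fun q => fiberSum f (fun a => g (a, q.2)) q.1 := fun g => by
    funext ⟨b, w⟩; exact fiberSum_prodMap_id f g b w
  -- complements are handled by subtraction, for which the finiteness on a piece is needed
  have hset : ∀ n, ∀ S : Set (A × Ω), MeasurableSet S →
      AEMeasurable (fiberSum (Prod.map f (id : Ω → Ω))
        (S.indicator fun p => (D n).indicator 1 p.1)) volume := by
    intro n S hS
    induction S, hS using MeasurableSpace.induction_on_inter
      generateFrom_prod.symm isPiSystem_prod with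
    | empty =>
      simp only [Set.indicator_empty, hfs]
      simp [fiberSum]
    | basic t ht =>
      obtain ⟨U, hU, V, hV, rfl⟩ := ht
      have : fiberSum (Prod.map f (id : Ω → Ω))
          ((U ×ˢ V).indicator fun p => (D n).indicator 1 p.1) =
          fun q => V.indicator 1 q.2 * fiberSum f ((U ∩ D n).indicator 1) q.1 := by
        rw [hfs]
        funext q
        unfold fiberSum
        rw [← ENNReal.tsum_mul_left]
        refine tsum_congr fun x => ?_
        by_cases h1 : x.1 ∈ U <;> by_cases h2 : q.2 ∈ V <;> by_cases h3 : x.1 ∈ D n <;>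
          simp [h1, h2, h3]
      rw [this]
      refine AEMeasurable.mul ((measurable_one.indicator hV).comp measurable_snd).aemeasurable ?_
      exact (h.aemeasurable_fiberSum _ (measurable_one.indicator (hU.inter (hDm n)))).comp_fst
    | compl t ht ih =>
      have htot : AEMeasurable (fun q : B × Ω => fiberSum f ((D n).indicator 1) q.1) volume :=
        (h.aemeasurable_fiberSum _ (measurable_one.indicator (hDm n))).comp_fst
      refine (htot.sub ih).congr ?_
      have hae : ∀ᵐ q : B × Ω, fiberSum f ((D n).indicator 1) q.1 ≠ ∞ :=
        Measure.quasiMeasurePreserving_fst.ae (hDfin n)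
      filter_upwards [hae] with q hq
      have hsum : fiberSum f ((D n).indicator 1) q.1 =
          fiberSum (Prod.map f (id : Ω → Ω)) (tᶜ.indicator fun p => (D n).indicator 1 p.1) q +
          fiberSum (Prod.map f (id : Ω → Ω)) (t.indicator fun p => (D n).indicator 1 p.1) q := by
        rw [← congrFun (fiberSum_add _ _ _) q, hfs]
        refine congrFun (congrArg _ (funext fun a => ?_)) _
        by_cases h1 : (a, q.2) ∈ t <;> simp [h1]
      simp only [Pi.sub_apply]
      rw [hsum] at hq ⊢
      exact ENNReal.add_sub_cancel_right (ENNReal.add_ne_top.1 hq).2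
    | iUnion s hd hs ih =>
      have : ((⋃ i, s i).indicator fun p : A × Ω => (D n).indicator (1 : A → ℝ≥0∞) p.1) =
          fun p => ∑' i, (s i).indicator (fun p : A × Ω => (D n).indicator 1 p.1) p := by
        funext p
        exact indicator_iUnion_eq_tsum hd _ p
      rw [this, fiberSum_tsum]
      exact AEMeasurable.tsum ih
  have hset' : ∀ S : Set (A × Ω), MeasurableSet S →
      AEMeasurable (fiberSum (Prod.map f (id : Ω → Ω)) (S.indicator 1)) volume := by
    intro S hS
    have : (S.indicator (1 : A × Ω → ℝ≥0∞)) =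
        fun p => ∑' n, S.indicator (fun p => (D n).indicator 1 p.1) p := by
      funext p
      by_cases hp : p ∈ S
      · simp only [Set.indicator_of_mem hp]
        rw [← indicator_iUnion_eq_tsum (disjoint_disjointed P) 1 p.1, iUnion_disjointed,
          hPU]
        simp
      · simp [hp]
    rw [this, fiberSum_tsum]
    exact AEMeasurable.tsum fun n => hset n S hS
  have hmeas : ∀ g : A × Ω → ℝ≥0∞, Measurable g →
      AEMeasurable (fiberSum (Prod.map f (id : Ω → Ω)) g) volume := by
    intro g hg
    refine Measurable.ennreal_induction (motive := fun g =>
      AEMeasurable (fiberSum (Prod.map f (id : Ω → Ω)) g) volume) ?_ ?_ ?_ hg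
    · intro c S hS
      have : fiberSum (Prod.map f (id : Ω → Ω)) (S.indicator fun _ => c) =
          fun y => c * fiberSum (Prod.map f (id : Ω → Ω)) (S.indicator 1) y := by
        funext y
        unfold fiberSum
        rw [← ENNReal.tsum_mul_left]
        refine tsum_congr fun x => ?_
        by_cases hx : x.1 ∈ S <;> simp [hx]
      rw [this]
      exact (hset' S hS).const_mul c
    · intro g₁ g₂ _ _ _ h₁ h₂
      exact (congrArg (AEMeasurable · volume) (fiberSum_add _ g₁ g₂)).mpr (h₁.add h₂)
    · intro g _ hmono ih
      rw [fiberSum_iSup _ hmono]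
      exact AEMeasurable.iSup ih
  refine ⟨h.measurable.prodMap measurable_id, h.measurable_jac.comp measurable_fst, hmeas, ?_⟩
  intro g hg
  rw [Measure.volume_eq_prod, Measure.volume_eq_prod,
    lintegral_prod_symm' (fun p : A × Ω => g p * J p.1)
      (hg.mul (h.measurable_jac.comp measurable_fst)),
    lintegral_prod_symm _ (hmeas g hg)]
  refine lintegral_congr fun w => ?_
  simp_rw [fiberSum_prodMap_id]
  exact h.lintegral_eq (fun a => g (a, w)) (hg.comp measurable_prodMk_right)

/-- The area formula: a differentiable map of a Euclidean space to itself has the absolute value of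
the determinant of its derivative as Jacobian. Where the derivative is invertible, the
source is cut into countably many pieces on which the map is injective; the critical values form
a null set. -/
theorem of_hasFDerivAt {E : Type*} [NormedAddCommGroup E] [NormedSpace ℝ E]
    [FiniteDimensional ℝ E] [MeasureSpace E] [BorelSpace E]
    [(volume : Measure E).IsAddHaarMeasure] {f : E → E} {f' : E → E →L[ℝ] E}
    (hf : ∀ x, HasFDerivAt f (f' x) x) (hJ : Measurable fun x => (f' x).det) :
    HasJac f fun x => ENNReal.ofReal |(f' x).det| := by
  have hJm : Measurable fun x => ENNReal.ofReal |(f' x).det| := by fun_prop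
  have hcont : Continuous f := continuous_iff_continuousAt.2 fun x => (hf x).continuousAt
  let Z : Set E := {x | (f' x).det = 0}
  have hZ : MeasurableSet Z := hJ (measurableSet_singleton 0)
  have hinv : ∀ A : E →L[ℝ] E, ∃ r : NNReal, r ≠ 0 ∧ (A.det ≠ 0 →
      ∀ s : Set E, ApproximatesLinearOn f A s r → Set.InjOn f s) := by
    intro A
    -- the radius is irrelevant for singular `A`, which do not occur among the approximations
    by_cases hA : A.det = 0
    · exact ⟨1, one_ne_zero, fun h => absurd hA h⟩
    · let B : E ≃L[ℝ] E := A.toContinuousLinearEquivOfDetNeZero hA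
      have hB : (B : E →L[ℝ] E) = A := A.coe_toContinuousLinearEquivOfDetNeZero hA
      rcases subsingleton_or_nontrivial E with hE | hE
      · exact ⟨1, one_ne_zero, fun _ s _ => Set.injOn_of_injective (Function.injective_of_subsingleton f)⟩
      · have hpos : 0 < ‖(B.symm : E →L[ℝ] E)‖₊ := B.nnnorm_symm_pos
        refine ⟨‖(B.symm : E →L[ℝ] E)‖₊⁻¹ / 2, by positivity, fun _ s hs => ?_⟩
        rw [← hB] at hs
        exact hs.injOn (Or.inr (NNReal.half_lt_self (by positivity)))
  choose r hr0 hr using hinv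
  obtain ⟨t, A, htd, htm, htU, htA, htf⟩ :=
    exists_partition_approximatesLinearOn_of_hasFDerivWithinAt f Zᶜ f'
      (fun x _ => (hf x).hasFDerivWithinAt) r hr0
  let T : ℕ → Set E := fun n => Zᶜ ∩ t n
  have hTm : ∀ n, MeasurableSet (T n) := fun n => hZ.compl.inter (htm n)
  have hTd : Pairwise (Function.onFun Disjoint T) := fun m n hmn =>
    (htd hmn).mono Set.inter_subset_right Set.inter_subset_right
  have hTU : ⋃ n, T n = Zᶜ := by
    rw [← Set.inter_iUnion]; exact Set.inter_eq_left.2 htU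
  have hTinj : ∀ n, Set.InjOn f (T n) := by
    intro n
    by_cases hne : (Zᶜ).Nonempty
    · obtain ⟨y, hy, hAy⟩ := htf hne n
      refine hr (A n) ?_ _ (htA n)
      rw [hAy]; exact hy
    · intro x hx
      exact absurd ⟨x, hx.1⟩ hne
  have hdecomp : ∀ g : E → ℝ≥0∞,
      g = fun x => Z.indicator g x + ∑' n, (T n).indicator g x := by
    intro g
    funext x
    rw [← indicator_iUnion_eq_tsum hTd, hTU, ← Pi.add_apply, Set.indicator_self_add_compl]
  have hZ0 : ∀ g : E → ℝ≥0∞, fiberSum f (Z.indicator g) =ᵐ[volume] fun _ => 0 := by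
    intro g
    have : volume (f '' Z) = 0 :=
      addHaar_image_eq_zero_of_det_fderivWithin_eq_zero volume
      (fun x _ => (hf x).hasFDerivWithinAt) fun x hx => hx
    filter_upwards [compl_mem_ae_iff.2 this] with y hy
    unfold fiberSum
    rw [ENNReal.tsum_eq_zero]
    intro x
    refine Set.indicator_of_notMem (fun hx => hy ⟨x.1, hx, x.2⟩) _
  have hpiece : ∀ g : E → ℝ≥0∞, Measurable g → ∀ n, Measurable (fiberSum f ((T n).indicator g)) := by
    intro g hg n
    rw [fiberSum_indicator_of_injOn (hTinj n)]
    exact (measurableEmbedding_of_fderivWithin (hTm n)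
      (fun x _ => (hf x).hasFDerivWithinAt) (hTinj n)).measurable_extend
      (hg.comp measurable_subtype_coe) measurable_const
  have hpieceInt : ∀ g : E → ℝ≥0∞, Measurable g → ∀ n,
      ∫⁻ y, fiberSum f ((T n).indicator g) y =
        ∫⁻ x, (T n).indicator g x * ENNReal.ofReal |(f' x).det| := by
    intro g hg n
    have h1 := lintegral_image_eq_lintegral_abs_det_fderiv_mul volume (hTm n)
      (fun x _ => (hf x).hasFDerivWithinAt) (hTinj n) (fiberSum f ((T n).indicator g))
    have h2 : (f '' T n).indicator (fiberSum f ((T n).indicator g)) =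
        fiberSum f ((T n).indicator g) := by
      rw [Set.indicator_eq_self]
      intro y hy
      by_contra hy'
      refine hy (ENNReal.tsum_eq_zero.2 fun x => Set.indicator_of_notMem (fun hx => hy' ?_) _)
      exact ⟨x.1, hx, x.2⟩
    rw [← lintegral_indicator (measurable_image_of_fderivWithin (hTm n)
      (fun x _ => (hf x).hasFDerivWithinAt) (hTinj n)), h2] at h1
    rw [h1, ← lintegral_indicator (hTm n)]
    refine lintegral_congr fun x => ?_
    by_cases hx : x ∈ T n
    · rw [Set.indicator_of_mem hx, Set.indicator_of_mem hx, mul_comm]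
      congr 1
      rw [fiberSum_indicator_of_injOn (hTinj n)]
      have hinj : Function.Injective fun x : T n => f x :=
        fun a b hab => Subtype.ext (hTinj n a.2 b.2 hab)
      exact hinj.extend_apply (fun x : T n => g x) _ ⟨x, hx⟩
    · simp [hx]
  refine ⟨hcont.measurable, hJm, fun g hg => ?_, fun g hg => ?_⟩
  · rw [hdecomp g, fiberSum_add, fiberSum_tsum]
    exact (aemeasurable_const.congr (hZ0 g).symm).add (Measurable.tsum (hpiece g hg)).aemeasurable
  · have hl : fiberSum f g =ᵐ[volume] fun y => ∑' n, fiberSum f ((T n).indicator g) y := by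
      conv_lhs => rw [hdecomp g, fiberSum_add, fiberSum_tsum]
      filter_upwards [hZ0 g] with y hy
      rw [hy, zero_add]
    have hr' : ∀ x, g x * ENNReal.ofReal |(f' x).det| =
        ∑' n, (T n).indicator g x * ENNReal.ofReal |(f' x).det| := by
      intro x
      rw [ENNReal.tsum_mul_right, ← indicator_iUnion_eq_tsum hTd, hTU]
      by_cases hx : x ∈ Z
      · have : (f' x).det = 0 := hx
        simp [this]
      · rw [Set.indicator_of_mem (show x ∈ Zᶜ from hx)]
    rw [lintegral_congr_ae hl, lintegral_tsum fun n => (hpiece g hg n).aemeasurable]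
    simp_rw [hpieceInt g hg]
    rw [lintegral_congr hr']
    exact lintegral_tsum fun n => ((hg.indicator (hTm n)).mul hJm).aemeasurable

end HasJac

/-! ### The phase-reduced sphere in affine coordinates -/

theorem l2norm_nonneg {k : ℕ} (v : Fin k → ℂ) : 0 ≤ l2norm v := Real.sqrt_nonneg _

theorem l2norm_sq {k : ℕ} (v : Fin k → ℂ) : l2norm v ^ 2 = ∑ i, ‖v i‖ ^ 2 :=
  Real.sq_sqrt (by positivity)

theorem l2norm_smul {k : ℕ} (c : ℂ) (v : Fin k → ℂ) : l2norm (c • v) = ‖c‖ * l2norm v := by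
  unfold l2norm
  simp_rw [Pi.smul_apply, norm_smul, mul_pow, ← Finset.mul_sum]
  rw [Real.sqrt_mul (by positivity), Real.sqrt_sq (norm_nonneg c)]

@[fun_prop]
theorem continuous_l2norm {k : ℕ} : Continuous (l2norm : (Fin k → ℂ) → ℝ) := by
  unfold l2norm; fun_prop

@[fun_prop]
theorem measurable_l2norm {k : ℕ} : Measurable (l2norm : (Fin k → ℂ) → ℝ) :=
  continuous_l2norm.measurable

/-- The point with affine coordinate `z` of complex projective space. -/
def affinePoint {k : ℕ} (z : Fin k → ℂ) : Fin (k + 1) → ℂ := Fin.cons 1 z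

/-- The unit vector with positive first coordinate on the line with affine coordinate `z`. -/
def chartRep {k : ℕ} (z : Fin k → ℂ) : Fin (k + 1) → ℂ :=
  (l2norm (affinePoint z) : ℂ)⁻¹ • affinePoint z

/-- The affine coordinate of the line through `u`, a junk value if `u 0 = 0`. -/
def chart {k : ℕ} (u : Fin (k + 1) → ℂ) : Fin k → ℂ := fun i => u i.succ / u 0

theorem l2norm_affinePoint_pos {k : ℕ} (z : Fin k → ℂ) : 0 < l2norm (affinePoint z) := by
  refine Real.sqrt_pos.2 ?_
  rw [Fin.sum_univ_succ]
  simp only [affinePoint, Fin.cons_zero, norm_one]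
  positivity

@[fun_prop]
theorem continuous_affinePoint {k : ℕ} : Continuous (affinePoint : (Fin k → ℂ) → _) := by
  refine continuous_pi fun i => ?_
  refine Fin.cases ?_ (fun j => ?_) i
  · simp only [affinePoint, Fin.cons_zero]; fun_prop
  · simp only [affinePoint, Fin.cons_succ]; fun_prop

@[fun_prop]
theorem measurable_affinePoint {k : ℕ} : Measurable (affinePoint : (Fin k → ℂ) → _) :=
  continuous_affinePoint.measurable

@[fun_prop]
theorem measurable_chartRep {k : ℕ} : Measurable (chartRep : (Fin k → ℂ) → _) := by
  unfold chartRep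
  fun_prop

theorem chartRep_zero {k : ℕ} (z : Fin k → ℂ) :
    chartRep z 0 = (l2norm (affinePoint z) : ℂ)⁻¹ := by
  simp [chartRep, affinePoint]

theorem smul_affinePoint_chart {k : ℕ} {u : Fin (k + 1) → ℂ} (hu : u 0 ≠ 0) :
    u 0 • affinePoint (chart u) = u := by
  funext i
  refine Fin.cases ?_ (fun j => ?_) i
  · simp [affinePoint]
  · simp [affinePoint, chart, mul_div_cancel₀ _ hu]

theorem chart_smul_affinePoint {k : ℕ} {c : ℂ} (hc : c ≠ 0) (z : Fin k → ℂ) :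
    chart (c • affinePoint z) = z := by
  funext i
  simp [affinePoint, chart, hc]

theorem phaseFix_smul_affinePoint {k : ℕ} {c : ℂ} (hc : c ≠ 0) (z : Fin k → ℂ) :
    phaseFix (c • affinePoint z) = chartRep z := by
  have h1 := (l2norm_affinePoint_pos z).ne'
  have h0 : (‖c‖ : ℂ) ≠ 0 := by simpa using hc
  have hN : (l2norm (affinePoint z) : ℂ) ≠ 0 := by exact_mod_cast h1
  unfold phaseFix chartRep
  rw [smul_smul, l2norm_smul]
  congr 1
  have h2 : star c * c = (‖c‖ : ℂ) ^ 2 := by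
    rw [mul_comm]; exact Complex.mul_conj' c
  simp only [Pi.smul_apply, affinePoint, Fin.cons_zero, smul_eq_mul, mul_one]
  push_cast
  change _ = (l2norm (affinePoint z) : ℂ)⁻¹
  rw [div_mul_eq_mul_div, h2]
  change (‖c‖ : ℂ) ^ 2 / (‖c‖ * (‖c‖ * (l2norm (affinePoint z) : ℂ))) = _
  field_simp

/-- The points of the phase-reduced sphere on the line with affine coordinate `z`. -/
theorem eq_or_eq_neg_chartRep {k : ℕ} {u : Fin (k + 1) → ℂ} (hu : u ∈ sphereSet k) :
    u = chartRep (chart u) ∨ u = -chartRep (chart u) := by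
  obtain ⟨h1, him, h0, -⟩ := hu
  have hre : u 0 = ((u 0).re : ℂ) := by
    apply Complex.ext <;> simp [him]
  have hN := l2norm_affinePoint_pos (chart u)
  have hn : |(u 0).re| * l2norm (affinePoint (chart u)) = 1 := by
    have := l2norm_smul (u 0) (affinePoint (chart u))
    rw [smul_affinePoint_chart h0, h1, hre, Complex.norm_real, Real.norm_eq_abs] at this
    simpa using this.symm
  have habs : |(u 0).re| = (l2norm (affinePoint (chart u)))⁻¹ := eq_inv_of_mul_eq_one_left hn
  rcases abs_choice (u 0).re with h | h
  · left
    conv_lhs => rw [← smul_affinePoint_chart h0, hre, ← h, habs]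
    rw [chartRep, Complex.ofReal_inv]
  · right
    have h' : (u 0).re = -|(u 0).re| := by rw [h, neg_neg]
    conv_lhs => rw [← smul_affinePoint_chart h0, hre, h', habs]
    rw [chartRep, Complex.ofReal_neg, Complex.ofReal_inv, neg_smul]

theorem chart_chartRep {k : ℕ} (z : Fin k → ℂ) : chart (chartRep z) = z :=
  chart_smul_affinePoint (by simpa using (l2norm_affinePoint_pos z).ne') z

theorem chart_neg {k : ℕ} (u : Fin (k + 1) → ℂ) : chart (-u) = chart u := by
  funext i; simp [chart]

theorem measurableSet_sphereSet (k : ℕ) : MeasurableSet (sphereSet k) := by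
  have h1 : MeasurableSet {u : Fin (k + 1) → ℂ | l2norm u = 1} :=
    measurable_l2norm (measurableSet_singleton 1)
  have h2 : MeasurableSet {u : Fin (k + 1) → ℂ | (u 0).im = 0} :=
    (Complex.measurable_im.comp (measurable_pi_apply 0)) (measurableSet_singleton 0)
  have h3 : MeasurableSet {u : Fin (k + 1) → ℂ | u 0 ≠ 0} :=
    (measurable_pi_apply 0 (measurableSet_singleton 0)).compl
  have h4 : MeasurableSet {u : Fin (k + 1) → ℂ | u ≠ e1 k} := (measurableSet_singleton _).compl
  exact h1.inter (h2.inter (h3.inter h4))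

@[fun_prop]
theorem measurable_phaseFix {k : ℕ} : Measurable (phaseFix : (Fin (k + 1) → ℂ) → _) := by
  unfold phaseFix
  fun_prop

/-- Integration over a disc of a power of the distance from the centre. -/
theorem lintegral_norm_pow_disc (k : ℕ) {c : ℝ} (hc : 0 < c) :
    ∫⁻ v : ℂ, {v : ℂ | ‖v‖ * c < 1}.indicator (fun v => ENNReal.ofReal (‖v‖ ^ (2 * k))) v =
      ENNReal.ofReal (Real.pi / (k + 1) * (c ^ (2 * (k + 1)))⁻¹) := by
  rw [← Complex.lintegral_comp_polarCoord_symm, polarCoord_target]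
  have h1 : ∀ p ∈ Set.Ioi (0 : ℝ) ×ˢ Set.Ioo (-Real.pi) Real.pi,
      ENNReal.ofReal p.1 • {v : ℂ | ‖v‖ * c < 1}.indicator
        (fun v => ENNReal.ofReal (‖v‖ ^ (2 * k))) (Complex.polarCoord.symm p) =
      (Set.Ioo (0 : ℝ) c⁻¹).indicator (fun r => ENNReal.ofReal (r ^ (2 * k + 1))) p.1 := by
    rintro ⟨r, t⟩ ⟨hr, -⟩
    have hr' : 0 < r := hr
    have hn : ‖Complex.polarCoord.symm (r, t)‖ = r := by
      rw [Complex.norm_polarCoord_symm]; exact abs_of_pos hr'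
    have hiff : Complex.polarCoord.symm (r, t) ∈ {v : ℂ | ‖v‖ * c < 1} ↔ r ∈ Set.Ioo (0 : ℝ) c⁻¹ := by
      rw [Set.mem_ofPred_eq, hn, Set.mem_Ioo, ← lt_div_iff₀ hc, one_div]
      exact ⟨fun h => ⟨hr', h⟩, fun h => h.2⟩
    by_cases h : r ∈ Set.Ioo (0 : ℝ) c⁻¹
    · rw [Set.indicator_of_mem (hiff.2 h), Set.indicator_of_mem h, hn, smul_eq_mul,
        ← ENNReal.ofReal_mul hr'.le, pow_succ']
    · rw [Set.indicator_of_notMem (fun h' => h (hiff.1 h')), Set.indicator_of_notMem h, smul_zero]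
  rw [setLIntegral_congr_fun (measurableSet_Ioi.prod measurableSet_Ioo) h1,
    Measure.volume_eq_prod, ← Measure.prod_restrict]
  have hm : Measurable ((Set.Ioo (0 : ℝ) c⁻¹).indicator
      (fun r => ENNReal.ofReal (r ^ (2 * k + 1)))) :=
    Measurable.indicator (by fun_prop) measurableSet_Ioo
  rw [lintegral_prod (fun p : ℝ × ℝ => (Set.Ioo (0 : ℝ) c⁻¹).indicator
    (fun r => ENNReal.ofReal (r ^ (2 * k + 1))) p.1) (hm.comp measurable_fst).aemeasurable]
  simp only [lintegral_const, Measure.restrict_apply_univ, Real.volume_Ioo]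
  rw [lintegral_mul_const _ hm, lintegral_indicator measurableSet_Ioo,
    Measure.restrict_restrict measurableSet_Ioo,
    Set.inter_eq_left.2 (show Set.Ioo (0 : ℝ) c⁻¹ ⊆ Set.Ioi 0 from fun x hx => hx.1),
    restrict_Ioo_eq_restrict_Ioc]
  have hint : IntegrableOn (fun r : ℝ => r ^ (2 * k + 1)) (Set.Ioc 0 c⁻¹) :=
    (Continuous.integrableOn_Icc (by fun_prop)).mono_set Set.Ioc_subset_Icc_self
  have hnn : 0 ≤ᵐ[volume.restrict (Set.Ioc 0 c⁻¹)] fun r : ℝ => r ^ (2 * k + 1) := by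
    refine (ae_restrict_iff' measurableSet_Ioc).2 (Filter.Eventually.of_forall fun r hr => ?_)
    exact pow_nonneg hr.1.le _
  rw [← ofReal_integral_eq_lintegral_ofReal hint hnn,
    ← intervalIntegral.integral_of_le (inv_nonneg.2 hc.le), integral_pow,
    ← ENNReal.ofReal_mul' (by linarith [Real.pi_pos])]
  congr 1
  have h2 : (2 * k + 1 + 1 : ℕ) = 2 * (k + 1) := by ring
  rw [h2, zero_pow (by positivity), inv_pow]
  push_cast
  field_simp
  ring

/-- Change of variables under an invertible linear map. -/
theorem lintegral_comp_linearMap {E : Type*} [NormedAddCommGroup E] [NormedSpace ℝ E]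
    [FiniteDimensional ℝ E] [MeasureSpace E] [BorelSpace E]
    [(volume : Measure E).IsAddHaarMeasure] (T : E →ₗ[ℝ] E) (hT : LinearMap.det T ≠ 0)
    {h : E → ℝ≥0∞} (hh : Measurable h) :
    ∫⁻ x, h (T x) * ENNReal.ofReal |LinearMap.det T| = ∫⁻ y, h y := by
  have hTm : Measurable T := T.continuous_of_finiteDimensional.measurable
  have h1 := Measure.map_linearMap_addHaar_eq_smul_addHaar (volume : Measure E) hT
  have h2 := lintegral_map (μ := volume) hh hTm
  rw [h1, lintegral_smul_measure, smul_eq_mul] at h2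
  rw [lintegral_mul_const _ (show Measurable fun x => h (T x) from hh.comp hTm), ← h2, mul_comm, ← mul_assoc,
    ← ENNReal.ofReal_mul (abs_nonneg _), abs_inv, mul_inv_cancel₀ (abs_ne_zero.2 hT),
    ENNReal.ofReal_one, one_mul]

/-- The determinant over `ℝ` of a complex linear map is the squared modulus of the determinant
over `ℂ`. -/
theorem abs_det_restrictScalars {E : Type*} [AddCommGroup E] [Module ℂ E] [Module ℝ E]
    [IsScalarTower ℝ ℂ E] [FiniteDimensional ℂ E] (T : E →ₗ[ℂ] E) :
    |LinearMap.det (T.restrictScalars ℝ)| = ‖LinearMap.det T‖ ^ 2 := by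
  rw [LinearMap.det_restrictScalars, Algebra.norm_complex_apply, Complex.normSq_eq_norm_sq,
    abs_of_nonneg (by positivity)]

theorem lintegral_comp_complex_linearMap {E : Type*} [NormedAddCommGroup E] [NormedSpace ℂ E]
    [NormedSpace ℝ E] [IsScalarTower ℝ ℂ E] [FiniteDimensional ℂ E] [FiniteDimensional ℝ E]
    [MeasureSpace E] [BorelSpace E]
    [(volume : Measure E).IsAddHaarMeasure] (T : E →ₗ[ℂ] E) (hT : LinearMap.det T ≠ 0)
    {h : E → ℝ≥0∞} (hh : Measurable h) :
    ∫⁻ x, h (T x) * ENNReal.ofReal (‖LinearMap.det T‖ ^ 2) = ∫⁻ y, h y := by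
  rw [← abs_det_restrictScalars]
  refine lintegral_comp_linearMap (T.restrictScalars ℝ) ?_ hh
  rw [← abs_ne_zero, abs_det_restrictScalars]
  exact pow_ne_zero _ (norm_ne_zero_iff.2 hT)

/-- The density, with respect to `dz`, of the volume of lines in the affine coordinate `z`. -/
def chartWeight {k : ℕ} (z : Fin k → ℂ) : ℝ≥0∞ :=
  ENNReal.ofReal ((l2norm (affinePoint z) ^ (2 * (k + 1)))⁻¹)

@[fun_prop]
theorem measurable_chartWeight {k : ℕ} : Measurable (chartWeight : (Fin k → ℂ) → _) := by
  unfold chartWeight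
  fun_prop

/-- The volume of lines in the affine coordinate: write a vector of the ball as `c • (1, z)`. The
substitution contributes `|c|^(2k)`, and `c` ranges over a disc of radius `1 / ‖(1, z)‖`. -/
theorem lintegral_unitBall_phaseFix {k : ℕ} {h : (Fin (k + 1) → ℂ) → ℝ≥0∞} (hh : Measurable h) :
    ENNReal.ofReal ((k + 1 : ℝ) / Real.pi) * ∫⁻ v in unitBall (k + 1), h (phaseFix v) =
      ∫⁻ z, h (chartRep z) * chartWeight z := by
  have hball : MeasurableSet (unitBall (k + 1)) := measurable_l2norm measurableSet_Iio
  let F : (Fin (k + 1) → ℂ) → ℝ≥0∞ := (unitBall (k + 1)).indicator fun v => h (phaseFix v)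
  have hF : Measurable F := (hh.comp measurable_phaseFix).indicator hball
  let e := MeasurableEquiv.piFinSuccAbove (fun _ : Fin (k + 1) => ℂ) 0
  have he : MeasurePreserving e := volume_preserving_piFinSuccAbove (fun _ : Fin (k + 1) => ℂ) 0
  have hes : ∀ p : ℂ × (Fin k → ℂ), e.symm p = Fin.cons p.1 p.2 := fun p => by
    simp [e, MeasurableEquiv.piFinSuccAbove, Fin.insertNthEquiv]
  have hcons : Measurable fun p : ℂ × (Fin k → ℂ) => (Fin.cons p.1 p.2 : Fin (k + 1) → ℂ) := by
    have := e.symm.measurable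
    rwa [show (e.symm : ℂ × (Fin k → ℂ) → (Fin (k + 1) → ℂ)) = _ from funext hes] at this
  have h1 : ∫⁻ v in unitBall (k + 1), h (phaseFix v) =
      ∫⁻ c : ℂ, ∫⁻ w : Fin k → ℂ, F (Fin.cons c w) := by
    rw [← lintegral_indicator hball, ← he.symm.lintegral_comp hF]
    simp_rw [hes]
    exact lintegral_prod _ (hF.comp hcons).aemeasurable
  -- for a fixed first coordinate `c`, the other coordinates are `c • z`
  have h2 : ∀ᵐ c : ℂ, ∫⁻ w : Fin k → ℂ, F (Fin.cons c w) =
      ∫⁻ z : Fin k → ℂ, {v : ℂ | ‖v‖ * l2norm (affinePoint z) < 1}.indicator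
        (fun v => ENNReal.ofReal (‖v‖ ^ (2 * k))) c * h (chartRep z) := by
    -- on the null set `c = 0` the affine coordinate is not defined
    have h0 : ∀ᵐ c : ℂ, c ≠ 0 := by simp [ae_iff]
    filter_upwards [h0] with c hc
    have hdet : LinearMap.det (c • (LinearMap.id : (Fin k → ℂ) →ₗ[ℂ] _)) = c ^ k := by
      simp
    rw [← lintegral_comp_complex_linearMap (c • (LinearMap.id : (Fin k → ℂ) →ₗ[ℂ] _))
      (by rw [hdet]; exact pow_ne_zero _ hc)
      (h := fun w : Fin k → ℂ => F (Fin.cons c w)) (hF.comp (hcons.comp measurable_prodMk_left))]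
    refine lintegral_congr fun z => ?_
    have hz : (Fin.cons c ((c • (LinearMap.id : (Fin k → ℂ) →ₗ[ℂ] _)) z) : Fin (k + 1) → ℂ) =
        c • affinePoint z := by
      funext i
      refine Fin.cases ?_ (fun j => ?_) i <;> simp [affinePoint]
    have hiff : c • affinePoint z ∈ unitBall (k + 1) ↔
        c ∈ {v : ℂ | ‖v‖ * l2norm (affinePoint z) < 1} := by
      rw [unitBall, Set.mem_ofPred_eq, Set.mem_ofPred_eq, l2norm_smul]
    rw [hz, hdet, norm_pow, ← pow_mul, mul_comm k 2]
    by_cases hb : c • affinePoint z ∈ unitBall (k + 1)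
    · simp only [F, Set.indicator_of_mem hb]
      rw [Set.indicator_of_mem (hiff.1 hb), phaseFix_smul_affinePoint hc, mul_comm]
    · simp only [F, Set.indicator_of_notMem hb]
      rw [Set.indicator_of_notMem (fun h' => hb (hiff.2 h')), zero_mul, zero_mul]
  rw [h1, lintegral_congr_ae h2, lintegral_lintegral_swap]
  · have h3 : ∀ z : Fin k → ℂ, ∫⁻ c : ℂ, {v : ℂ | ‖v‖ * l2norm (affinePoint z) < 1}.indicator
        (fun v => ENNReal.ofReal (‖v‖ ^ (2 * k))) c * h (chartRep z) =
        ENNReal.ofReal (Real.pi / (k + 1)) * (h (chartRep z) * chartWeight z) := by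
      intro z
      rw [lintegral_mul_const, lintegral_norm_pow_disc k (l2norm_affinePoint_pos z),
        ENNReal.ofReal_mul (by positivity), chartWeight]
      · ring
      · refine Measurable.indicator (by fun_prop) ?_
        exact measurableSet_lt (by fun_prop) measurable_const
    simp_rw [h3]
    rw [lintegral_const_mul _ (by fun_prop), ← mul_assoc, ← ENNReal.ofReal_mul (by positivity)]
    have : ((k + 1 : ℝ) / Real.pi) * (Real.pi / (k + 1)) = 1 := by
      have := Real.pi_pos
      field_simp
    rw [this, ENNReal.ofReal_one, one_mul]
  · have hS : MeasurableSet {p : ℂ × (Fin k → ℂ) | ‖p.1‖ * l2norm (affinePoint p.2) < 1} :=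
      measurableSet_lt (by fun_prop) measurable_const
    have : Measurable (({p : ℂ × (Fin k → ℂ) | ‖p.1‖ * l2norm (affinePoint p.2) < 1}.indicator
      (fun p => ENNReal.ofReal (‖p.1‖ ^ (2 * k)))) * fun p => h (chartRep p.2)) :=
      (Measurable.indicator (by fun_prop) hS).mul (by fun_prop)
    exact this.aemeasurable

/-- The measure on the ambient space from which the volume of the sphere is induced. -/
def ambientVolume (k : ℕ) : Measure (Fin (k + 1) → ℂ) :=
  ENNReal.ofReal ((k + 1 : ℝ) / Real.pi) •
    (Measure.map phaseFix ((volume : Measure (Fin (k + 1) → ℂ)).restrict (unitBall (k + 1))) +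
      Measure.map (fun v => -phaseFix v)
        ((volume : Measure (Fin (k + 1) → ℂ)).restrict (unitBall (k + 1))))

theorem lintegral_ambientVolume {k : ℕ} {h : (Fin (k + 1) → ℂ) → ℝ≥0∞} (hh : Measurable h) :
    ∫⁻ v, h v ∂ambientVolume k =
      ∫⁻ z, (h (chartRep z) + h (-chartRep z)) * chartWeight z := by
  have hn : Measurable fun v => h (-v) := hh.comp measurable_neg
  rw [ambientVolume, lintegral_smul_measure, lintegral_add_measure,
    lintegral_map hh measurable_phaseFix,
    lintegral_map hh (show Measurable fun v => -phaseFix v from measurable_phaseFix.neg), smul_eq_mul,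
    mul_add, lintegral_unitBall_phaseFix hh, lintegral_unitBall_phaseFix hn]
  simp_rw [add_mul]
  rw [lintegral_add_left (by fun_prop)]

theorem measurableEmbedding_sphere (k : ℕ) :
    MeasurableEmbedding (Subtype.val : Sphere k → (Fin (k + 1) → ℂ)) :=
  MeasurableEmbedding.subtype_coe (measurableSet_sphereSet k)

@[fun_prop]
theorem measurable_sphere_val (k : ℕ) :
    Measurable (fun u : Sphere k => (u.1 : Fin (k + 1) → ℂ)) :=
  (measurableEmbedding_sphere k).measurable

/-- Integration over the phase-reduced sphere in the affine coordinate. The missing point `e1` is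
accounted for by the vanishing of `h` off the sphere. -/
theorem lintegral_sphere {k : ℕ} {h : (Fin (k + 1) → ℂ) → ℝ≥0∞} (hh : Measurable h)
    (h0 : ∀ v, v ∉ sphereSet k → h v = 0) :
    ∫⁻ u : Sphere k, h u.1 = ∫⁻ z, (h (chartRep z) + h (-chartRep z)) * chartWeight z := by
  have h1 : (volume : Measure (Sphere k)) =
    Measure.comap (Subtype.val : sphereSet k → (Fin (k + 1) → ℂ)) (ambientVolume k) := rfl
  have h2 := lintegral_subtype_comap (μ := ambientVolume k) (measurableSet_sphereSet k) h
  rw [← lintegral_ambientVolume hh]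
  refine h2.trans ?_
  rw [← lintegral_indicator (measurableSet_sphereSet k)]
  congr 1
  rw [Set.indicator_eq_self]
  intro v hv
  by_contra hvs
  exact hv (h0 v hvs)

instance (k : ℕ) : IsFiniteMeasure (volume : Measure (Sphere k)) := by
  have hball : volume (unitBall (k + 1)) < ∞ := by
    refine (measure_mono (t := Metric.closedBall 0 1) fun v hv => ?_).trans_lt
      measure_closedBall_lt_top
    rw [mem_closedBall_zero_iff, pi_norm_le_iff_of_nonneg zero_le_one]
    intro i
    have h1 : ‖v i‖ ^ 2 ≤ l2norm v ^ 2 := by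
      rw [l2norm_sq]
      exact Finset.single_le_sum (f := fun i => ‖v i‖ ^ 2) (fun _ _ => by positivity)
        (Finset.mem_univ i)
    exact (pow_le_pow_iff_left₀ (norm_nonneg _) (l2norm_nonneg v) two_ne_zero).1 h1 |>.trans
      (le_of_lt hv)
  have hA : IsFiniteMeasure (ambientVolume k) := by
    constructor
    rw [ambientVolume, Measure.smul_apply, Measure.add_apply,
      Measure.map_apply measurable_phaseFix MeasurableSet.univ,
      Measure.map_apply (show Measurable fun v => -phaseFix v from measurable_phaseFix.neg)
        MeasurableSet.univ]
    simp only [Set.preimage_univ, Measure.restrict_apply_univ, smul_eq_mul]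
    exact ENNReal.mul_lt_top ENNReal.ofReal_lt_top (ENNReal.add_lt_top.2 ⟨hball, hball⟩)
  constructor
  have h1 := (measurableEmbedding_sphere k).comap_apply (ambientVolume k) Set.univ
  exact h1.trans_lt (measure_lt_top _ _)

theorem chartRep_ne_neg {k : ℕ} (z : Fin k → ℂ) : chartRep z ≠ -chartRep z := by
  intro h
  have h1 := congrFun h 0
  rw [Pi.neg_apply, self_eq_neg, chartRep_zero, inv_eq_zero, Complex.ofReal_eq_zero] at h1
  exact (l2norm_affinePoint_pos z).ne' h1

/-- The affine coordinate as a map on the phase-reduced sphere. Each line is met in the two points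
`± chartRep z`, except that `e1` is missing. -/
theorem hasJac_chart (k : ℕ) :
    HasJac (fun u : Sphere k => chart u.1)
      (fun u : Sphere k => ENNReal.ofReal ((‖u.1 0‖ ^ (2 * (k + 1)))⁻¹)) := by
  have hchart : Measurable (chart : (Fin (k + 1) → ℂ) → _) := by
    unfold chart; fun_prop
  have hext : ∀ g : Sphere k → ℝ≥0∞, ∀ u : Sphere k,
      Function.extend Subtype.val g (fun _ => 0) u.1 = g u := fun g u =>
    Subtype.val_injective.extend_apply g _ u
  have hext0 : ∀ g : Sphere k → ℝ≥0∞, ∀ v, v ∉ sphereSet k →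
      Function.extend (Subtype.val : Sphere k → (Fin (k + 1) → ℂ)) g (fun _ => 0) v = 0 :=
    fun g v hv => Function.extend_apply' g _ v fun ⟨u, hu⟩ => hv (hu ▸ u.2)
  have hextm : ∀ g : Sphere k → ℝ≥0∞, Measurable g →
      Measurable (Function.extend (Subtype.val : Sphere k → (Fin (k + 1) → ℂ)) g (fun _ => 0)) :=
    fun g hg => (measurableEmbedding_sphere k).measurable_extend hg measurable_const
  have hfib : ∀ g : Sphere k → ℝ≥0∞, ∀ z, fiberSum (fun u : Sphere k => chart u.1) g z =
      Function.extend Subtype.val g (fun _ => 0) (chartRep z) +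
      Function.extend Subtype.val g (fun _ => 0) (-chartRep z) := by
    intro g z
    set G := Function.extend (Subtype.val : Sphere k → (Fin (k + 1) → ℂ)) g (fun _ => 0) with hG
    rw [fiberSum_eq_tsum]
    have h1 : ∀ u : Sphere k, ((fun u : Sphere k => chart u.1) ⁻¹' {z}).indicator g u =
        ({chartRep z, -chartRep z} : Set (Fin (k + 1) → ℂ)).indicator G u.1 := by
      intro u
      by_cases hu : chart u.1 = z
      · have h2 : u.1 ∈ ({chartRep z, -chartRep z} : Set (Fin (k + 1) → ℂ)) := by
          have := eq_or_eq_neg_chartRep u.2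
          rwa [hu] at this
        rw [Set.indicator_of_mem h2, Set.indicator_of_mem (by exact hu), hG, hext]
      · have h2 : u.1 ∉ ({chartRep z, -chartRep z} : Set (Fin (k + 1) → ℂ)) := by
          rintro (h | h) <;> refine hu ?_
          · rw [h, chart_chartRep]
          · rw [Set.mem_singleton_iff.1 h, chart_neg, chart_chartRep]
        rw [Set.indicator_of_notMem h2, Set.indicator_of_notMem (by exact hu)]
    simp_rw [h1]
    refine (Function.Injective.tsum_eq (g := (Subtype.val : Sphere k → (Fin (k + 1) → ℂ)))
      (f := ({chartRep z, -chartRep z} : Set (Fin (k + 1) → ℂ)).indicator G)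
      Subtype.val_injective ?_).trans ?_
    rotate_left
    · rw [tsum_eq_sum (s := {chartRep z, -chartRep z}), Finset.sum_pair (chartRep_ne_neg z),
        Set.indicator_of_mem (by simp), Set.indicator_of_mem (by simp)]
      intro v hv
      exact Set.indicator_of_notMem (by simpa using hv) _
    · intro v hv
      by_contra hvs
      refine hv ?_
      rw [Set.indicator_apply_eq_zero]
      intro _
      exact hext0 g v fun hvm => hvs ⟨⟨v, hvm⟩, rfl⟩
  have hJm : Measurable fun u : Sphere k => ENNReal.ofReal ((‖u.1 0‖ ^ (2 * (k + 1)))⁻¹) := by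
    have : Measurable fun u : Sphere k => u.1 0 :=
      (measurable_pi_apply 0).comp (measurable_sphere_val k)
    exact (this.norm.pow_const _).inv.ennreal_ofReal
  refine ⟨hchart.comp (measurable_sphere_val k), hJm, fun g hg => ?_, fun g hg => ?_⟩
  · rw [funext (hfib g)]
    have := hextm g hg
    exact Measurable.aemeasurable (by fun_prop)
  · simp_rw [hfib]
    let G := Function.extend (Subtype.val : Sphere k → (Fin (k + 1) → ℂ)) g (fun _ => 0)
    let H : (Fin (k + 1) → ℂ) → ℝ≥0∞ := fun v =>
      G v * ENNReal.ofReal ((‖v 0‖ ^ (2 * (k + 1)))⁻¹)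
    have hGm : Measurable G := hextm g hg
    have hH : Measurable H := by fun_prop
    have h1 : ∀ u : Sphere k, g u * ENNReal.ofReal ((‖u.1 0‖ ^ (2 * (k + 1)))⁻¹) = H u.1 :=
      fun u => by simp only [H, G, hext]
    simp_rw [h1]
    rw [lintegral_sphere hH fun v hv => by simp only [H, G, hext0 g v hv, zero_mul]]
    refine lintegral_congr fun z => ?_
    have h2 : ‖chartRep z 0‖ = (l2norm (affinePoint z))⁻¹ := by
      rw [chartRep_zero, norm_inv, Complex.norm_real, Real.norm_eq_abs,
        abs_of_pos (l2norm_affinePoint_pos z)]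
    have h3 : ENNReal.ofReal ((((l2norm (affinePoint z))⁻¹) ^ (2 * (k + 1)))⁻¹) * chartWeight z
        = 1 := by
      have := l2norm_affinePoint_pos z
      rw [chartWeight, ← ENNReal.ofReal_mul (by positivity), ← ENNReal.ofReal_one]
      congr 1
      rw [inv_pow, inv_inv]
      exact mul_inv_cancel₀ (by positivity)
    simp only [H, Pi.neg_apply, norm_neg, h2]
    rw [← add_mul, mul_assoc, h3, mul_one]

/-! ### The Householder reflection -/

open Matrix in
theorem dotProduct_star_self {k : ℕ} (v : Fin k → ℂ) : star v ⬝ᵥ v = (l2norm v : ℂ) ^ 2 := by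
  rw [← Complex.ofReal_pow, l2norm_sq, dotProduct]
  push_cast
  refine Finset.sum_congr rfl fun i _ => ?_
  exact Complex.conj_mul' (v i)

section Householder

variable {k : ℕ} (u : Sphere k)

theorem sphere_ne_zero : u.1 0 ≠ 0 := u.2.2.2.1

theorem star_sphere_zero : star (u.1 0) = u.1 0 :=
  Complex.conj_eq_iff_im.2 u.2.2.1

theorem sum_sphere : star (u.1 0) * u.1 0 + ∑ i : Fin k, star (u.1 i.succ) * u.1 i.succ = 1 := by
  have h := dotProduct_star_self u.1
  rw [u.2.1, dotProduct, Fin.sum_univ_succ] at h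
  simpa using h

theorem l2norm_e1_sub_sq : (l2norm (e1 k - u.1) : ℂ) ^ 2 = 2 * (1 - u.1 0) := by
  have h := sum_sphere u
  rw [← dotProduct_star_self, dotProduct, Fin.sum_univ_succ]
  have h1 : ∀ i : Fin k, star (e1 k - u.1) i.succ * (e1 k - u.1) i.succ =
      star (u.1 i.succ) * u.1 i.succ := fun i => by simp [e1]
  simp_rw [h1]
  have h2 : star (e1 k - u.1) 0 * (e1 k - u.1) 0 = (1 - u.1 0) * (1 - u.1 0) := by
    simp only [e1, Pi.star_apply, Pi.sub_apply, Pi.single_eq_same, star_sub, star_one,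
      star_sphere_zero]
  rw [h2]
  rw [star_sphere_zero] at h
  linear_combination h

theorem l2norm_e1_sub_ne_zero : (l2norm (e1 k - u.1) : ℂ) ^ 2 ≠ 0 := by
  intro h
  have h1 : ∑ i, ‖(e1 k - u.1) i‖ ^ 2 = 0 := by
    rw [← l2norm_sq]; exact_mod_cast h
  rw [Finset.sum_eq_zero_iff_of_nonneg (fun _ _ => by positivity)] at h1
  refine u.2.2.2.2 (funext fun i => ?_)
  have := h1 i (Finset.mem_univ i)
  rw [sq_eq_zero_iff, norm_eq_zero, Pi.sub_apply, sub_eq_zero] at this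
  exact this.symm

theorem one_sub_sphere_ne_zero : 1 - u.1 0 ≠ 0 := by
  intro h
  have := l2norm_e1_sub_ne_zero u
  rw [l2norm_e1_sub_sq, h, mul_zero] at this
  exact this rfl

theorem householder_mul_self : householder u * householder u = 1 := by
  have hn := l2norm_e1_sub_ne_zero u
  rw [householder, sub_mul, mul_sub, mul_sub, one_mul, mul_one, one_mul, smul_mul_smul_comm,
    Matrix.vecMulVec_mul_vecMulVec, dotProduct_star_self, Matrix.vecMulVec_smul, smul_smul]
  set n : ℂ := (l2norm (e1 k - u.1) : ℂ) ^ 2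
  have : 2 / n * (2 / n) * n = 2 / n + 2 / n := by field_simp; ring
  rw [this, add_smul]
  abel

open Matrix in
theorem householder_mulVec_e1 : householder u *ᵥ e1 k = u.1 := by
  have hn := one_sub_sphere_ne_zero u
  rw [householder, sub_mulVec, one_mulVec, smul_mulVec, vecMulVec_mulVec, l2norm_e1_sub_sq]
  have h1 : star (e1 k - u.1) ⬝ᵥ e1 k = 1 - u.1 0 := by
    rw [e1, dotProduct_single, mul_one, Pi.star_apply, Pi.sub_apply, Pi.single_eq_same, star_sub,
      star_one, star_sphere_zero]
  rw [h1]
  funext i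
  simp only [Pi.sub_apply, Pi.smul_apply, smul_eq_mul, MulOpposite.smul_eq_mul_unop,
    MulOpposite.unop_op]
  field_simp
  ring

open Matrix in
theorem householder_mulVec : householder u *ᵥ u.1 = e1 k := by
  rw [← householder_mulVec_e1 u, mulVec_mulVec, householder_mul_self, one_mulVec]

theorem householder_zero_zero : householder u 0 0 = u.1 0 := by
  have h := congrFun (householder_mulVec_e1 u) 0
  simpa [e1] using h

open Matrix in
theorem householder_mulVec_affinePoint :
    householder u *ᵥ affinePoint (chart u.1) = (u.1 0)⁻¹ • e1 k := by
  have h : affinePoint (chart u.1) = (u.1 0)⁻¹ • u.1 := by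
    rw [eq_inv_smul_iff₀ (sphere_ne_zero u)]
    exact smul_affinePoint_chart (sphere_ne_zero u)
  rw [h, mulVec_smul, householder_mulVec]

/-- The lower right block of the Householder reflection. -/
def householderBlock : Matrix (Fin k) (Fin k) ℂ := (householder u).submatrix Fin.succ Fin.succ

/-- The inverse of `householderBlock`, by the Sherman–Morrison formula. -/
def householderBlockInv : Matrix (Fin k) (Fin k) ℂ :=
  1 - (1 / ((1 - u.1 0) * u.1 0)) •
    Matrix.vecMulVec (fun i => u.1 i.succ) (star fun i => u.1 i.succ)

theorem householderBlock_eq : householderBlock u =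
    1 - (1 / (1 - u.1 0)) • Matrix.vecMulVec (fun i => u.1 i.succ) (star fun i => u.1 i.succ) := by
  have hn := one_sub_sphere_ne_zero u
  ext i j
  rw [householderBlock, householder, l2norm_e1_sub_sq]
  simp only [Matrix.submatrix_apply,
    Matrix.sub_apply, Matrix.smul_apply, Matrix.vecMulVec_apply, Pi.sub_apply, Pi.star_apply,
    smul_eq_mul, e1, star_sub]
  rw [Pi.single_eq_of_ne (Fin.succ_ne_zero i), Pi.single_eq_of_ne (Fin.succ_ne_zero j)]
  have : (1 : Matrix (Fin (k + 1)) (Fin (k + 1)) ℂ) i.succ j.succ = (1 : Matrix _ _ ℂ) i j := by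
    simp [Matrix.one_apply]
  rw [this, star_zero]
  field_simp
  ring

open Matrix in
theorem dotProduct_tail :
    star (fun i : Fin k => u.1 i.succ) ⬝ᵥ (fun i : Fin k => u.1 i.succ) = (1 - u.1 0) * (1 + u.1 0) := by
  have h := sum_sphere u
  rw [star_sphere_zero] at h
  rw [dotProduct]
  simp only [Pi.star_apply]
  linear_combination h

theorem householderBlock_mul_inv : householderBlock u * householderBlockInv u = 1 := by
  have hn := one_sub_sphere_ne_zero u
  have h0 := sphere_ne_zero u
  rw [householderBlock_eq, householderBlockInv, sub_mul, mul_sub, mul_sub, one_mul, mul_one,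
    one_mul, smul_mul_smul_comm, Matrix.vecMulVec_mul_vecMulVec, dotProduct_tail,
    Matrix.vecMulVec_smul, smul_smul]
  set V := Matrix.vecMulVec (fun i : Fin k => u.1 i.succ) (star fun i : Fin k => u.1 i.succ)
  have : 1 / (1 - u.1 0) * (1 / ((1 - u.1 0) * u.1 0)) * ((1 - u.1 0) * (1 + u.1 0)) =
      1 / ((1 - u.1 0) * u.1 0) + 1 / (1 - u.1 0) := by
    field_simp
  rw [this, add_smul]
  abel

theorem householderBlock_inv_mul : householderBlockInv u * householderBlock u = 1 :=
  mul_eq_one_comm.1 (householderBlock_mul_inv u)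

theorem det_householderBlock : (householderBlock u).det = -u.1 0 := by
  have hn := one_sub_sphere_ne_zero u
  rw [householderBlock_eq, ← Matrix.smul_vecMulVec, sub_eq_add_neg, ← Matrix.neg_vecMulVec,
    Matrix.vecMulVec_eq Unit, Matrix.det_one_add_replicateCol_mul_replicateRow]
  simp only [dotProduct_neg, dotProduct_smul, dotProduct_tail, smul_eq_mul]
  field_simp
  ring

end Householder

open Matrix in
theorem stepR_mulVec_affinePoint {k : ℕ} (lam : ℂ) (u : Sphere k) (w : Fin k → ℂ)
    (M : Matrix (Fin k) (Fin k) ℂ) :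
    stepR lam u w M *ᵥ affinePoint (chart u.1) = lam • affinePoint (chart u.1) := by
  have h1 : blockR lam w M *ᵥ e1 k = lam • e1 k := by
    funext i
    refine Fin.cases ?_ (fun j => ?_) i <;> simp [e1, blockR]
  have h2 : householder u *ᵥ ((u.1 0)⁻¹ • e1 k) = affinePoint (chart u.1) := by
    rw [← householder_mulVec_affinePoint, mulVec_mulVec, householder_mul_self, one_mulVec]
  rw [stepR, ← mulVec_mulVec, ← mulVec_mulVec, householder_mulVec_affinePoint, mulVec_smul, h1,
    smul_comm, mulVec_smul, h2]

/-- The determinant of the eigenvector equation in affine coordinates. Adding multiples of the other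
columns turns the matrix into `(lam - X) + z e1ᵀ`, where `z` is the affine representative of the
eigenvector, and conjugation by the reflection makes this block triangular. -/
theorem det_affine_column {k : ℕ} (lam : ℂ) (u : Sphere k) (w : Fin k → ℂ)
    (M : Matrix (Fin k) (Fin k) ℂ) :
    (Matrix.of fun i => Fin.cons (affinePoint (chart u.1) i) fun j : Fin k =>
      (lam • (1 : Matrix (Fin (k + 1)) (Fin (k + 1)) ℂ) - stepR lam u w M) i j.succ :
        Matrix (Fin (k + 1)) (Fin (k + 1)) ℂ).det = (Matrix.scalar (Fin k) lam - M).det := by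
  set N := lam • (1 : Matrix (Fin (k + 1)) (Fin (k + 1)) ℂ) - stepR lam u w M with hN
  set z := affinePoint (chart u.1) with hz
  set Q : Matrix (Fin (k + 1)) (Fin (k + 1)) ℂ :=
    Matrix.of fun i => Fin.cons (z i) fun j : Fin k => N i j.succ with hQ
  let T : Matrix (Fin (k + 1)) (Fin (k + 1)) ℂ :=
    Matrix.of fun i => Fin.cons ((Fin.cons 1 fun l => -chart u.1 l : Fin (k + 1) → ℂ) i)
      fun j : Fin k => (1 : Matrix (Fin (k + 1)) (Fin (k + 1)) ℂ) i j.succ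
  have hT : T.det = 1 := by
    rw [Matrix.det_succ_row_zero, Fin.sum_univ_succ]
    have h1 : T.submatrix Fin.succ (Fin.succAbove 0) = 1 := by
      ext i j
      simp [T, Matrix.one_apply]
    rw [h1]
    simp [T, Matrix.one_apply, (Fin.succ_ne_zero _).symm]
  have hNz : N.mulVec z = 0 := by
    rw [hN, Matrix.sub_mulVec, Matrix.smul_mulVec, Matrix.one_mulVec, hz,
      stepR_mulVec_affinePoint, sub_self]
  have hQT : Q * T = N + Matrix.vecMulVec z (e1 k) := by
    ext i j
    rw [Matrix.mul_apply, Fin.sum_univ_succ]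
    refine Fin.cases ?_ (fun j => ?_) j
    · have h1 := congrFun hNz i
      rw [Matrix.mulVec, dotProduct, Fin.sum_univ_succ] at h1
      simp only [hz, affinePoint, Fin.cons_zero, Fin.cons_succ, mul_one, Pi.zero_apply] at h1
      simp only [Q, T, e1, Matrix.of_apply, Fin.cons_zero, Fin.cons_succ, Matrix.add_apply,
        Matrix.vecMulVec_apply, Pi.single_eq_same, mul_one, mul_neg, Finset.sum_neg_distrib]
      linear_combination -h1
    · simp [Q, T, e1, Matrix.one_apply, Matrix.vecMulVec_apply, (Fin.succ_ne_zero _).symm]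
  have hRN : householder u * N * householder u =
      lam • (1 : Matrix (Fin (k + 1)) (Fin (k + 1)) ℂ) - blockR lam w M := by
    have hRR := householder_mul_self u
    rw [hN, mul_sub, sub_mul, stepR, mul_smul_comm, mul_one, smul_mul_assoc, hRR]
    congr 1
    calc householder u * (householder u * blockR lam w M * householder u) * householder u
        = (householder u * householder u) * blockR lam w M * (householder u * householder u) := by
          noncomm_ring
      _ = _ := by rw [hRR, one_mul, mul_one]
  set C := householder u * (Q * T) * householder u with hC
  have hCdet : C.det = Q.det := by
    have h2 : (householder u).det * (householder u).det = 1 := by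
      rw [← Matrix.det_mul, householder_mul_self, Matrix.det_one]
    rw [hC, Matrix.det_mul, Matrix.det_mul, Matrix.det_mul, hT]
    linear_combination Q.det * h2
  have hCeq : C = lam • (1 : Matrix (Fin (k + 1)) (Fin (k + 1)) ℂ) - blockR lam w M +
      Matrix.vecMulVec ((u.1 0)⁻¹ • e1 k) (householder u 0) := by
    rw [hC, hQT, mul_add, add_mul, hRN, Matrix.mul_vecMulVec, Matrix.vecMulVec_mul, hz,
      householder_mulVec_affinePoint]
    congr 2
    rw [e1, Matrix.single_one_vecMul]
    rfl
  rw [← hCdet, Matrix.det_succ_column_zero, Fin.sum_univ_succ]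
  have h00 : C 0 0 = 1 := by
    rw [hCeq]
    simp [blockR, Matrix.vecMulVec_apply, e1, householder_zero_zero, sphere_ne_zero u]
  have hs0 : ∀ i : Fin k, C i.succ 0 = 0 := fun i => by
    rw [hCeq]
    simp [blockR, Matrix.vecMulVec_apply, e1]
  have hsub : C.submatrix (Fin.succAbove 0) Fin.succ = Matrix.scalar (Fin k) lam - M := by
    ext i j
    rw [hCeq]
    simp [blockR, Matrix.vecMulVec_apply, e1, Matrix.one_apply, Matrix.diagonal_apply]
  rw [hsub]
  simp [h00, hs0]

/-! ### Measure-preserving rearrangements and conjugation by the reflection -/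

/-- A linear involution preserves Lebesgue measure. -/
theorem measurePreserving_of_involutive {E : Type*} [NormedAddCommGroup E] [NormedSpace ℝ E]
    [FiniteDimensional ℝ E] [MeasureSpace E] [BorelSpace E]
    [(volume : Measure E).IsAddHaarMeasure] (T : E →ₗ[ℝ] E) (hT : Function.Involutive T) :
    MeasurePreserving T := by
  have h1 : LinearMap.det T * LinearMap.det T = 1 := by
    rw [← LinearMap.det_comp, show T ∘ₗ T = LinearMap.id from LinearMap.ext hT, LinearMap.det_id]
  have h2 : |LinearMap.det T| = 1 := by
    rcases mul_self_eq_one_iff.1 h1 with h | h <;> rw [h] <;> simp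
  have h0 : LinearMap.det T ≠ 0 := fun h => by simp [h] at h1
  refine ⟨T.continuous_of_finiteDimensional.measurable, ?_⟩
  rw [Measure.map_linearMap_addHaar_eq_smul_addHaar volume h0, abs_inv, h2, inv_one,
    ENNReal.ofReal_one, one_smul]

theorem measurePreserving_star (k : ℕ) : MeasurePreserving (star : (Fin k → ℂ) → (Fin k → ℂ)) :=
  measurePreserving_of_involutive
    { toFun := star
      map_add' := fun x y => star_add x y
      map_smul' := fun r x => by ext i; simp } star_involutive

theorem measurePreserving_conj : MeasurePreserving (star : ℂ → ℂ) :=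
  measurePreserving_of_involutive
    { toFun := star
      map_add' := fun x y => star_add x y
      map_smul' := fun r x => by simp } star_involutive

theorem measurePreserving_conjTranspose (n : ℕ) :
    MeasurePreserving (Matrix.conjTranspose : Matrix (Fin n) (Fin n) ℂ → _) := by
  have h : MeasurePreserving (fun (X : Fin n → Fin n → ℂ) i j => star (X j i)) :=
    measurePreserving_of_involutive
      { toFun := fun (X : Fin n → Fin n → ℂ) i j => star (X j i)
        map_add' := fun x y => by ext i j; simp
        map_smul' := fun r x => by ext i j; simp } fun X => by ext i j; simp
  exact h

instance (n : ℕ) : SigmaFinite (volume : Measure (Matrix (Fin n) (Fin n) ℂ)) :=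
  inferInstanceAs (SigmaFinite (volume : Measure (Fin n → Fin n → ℂ)))

theorem measurePreserving_prod_leftComm {A B C : Type*} [MeasureSpace A] [MeasureSpace B]
    [MeasureSpace C] [SFinite (volume : Measure A)] [SFinite (volume : Measure B)]
    [SFinite (volume : Measure C)] :
    MeasurePreserving (fun p : A × (B × C) => (p.2.1, (p.1, p.2.2))) := by
  have h1 : MeasurePreserving (MeasurableEquiv.prodAssoc : (A × B) × C ≃ᵐ A × (B × C)) :=
    volume_preserving_prodAssoc
  have h2 : MeasurePreserving (Prod.map Prod.swap id : (A × B) × C → (B × A) × C) :=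
    Measure.measurePreserving_swap.prod (MeasurePreserving.id volume)
  have h3 : MeasurePreserving (MeasurableEquiv.prodAssoc : (B × A) × C ≃ᵐ B × (A × C)) :=
    volume_preserving_prodAssoc
  exact (h3.comp h2).comp (h1.symm _)

theorem measurePreserving_cons {A : Type} [MeasureSpace A] [SigmaFinite (volume : Measure A)]
    (k : ℕ) : MeasurePreserving (fun p : A × (Fin k → A) => (Fin.cons p.1 p.2 : Fin (k + 1) → A)) := by
  have h := (volume_preserving_piFinSuccAbove (fun _ : Fin (k + 1) => A) 0).symm
  convert h using 1
  funext p
  simp [MeasurableEquiv.piFinSuccAbove, Fin.insertNthEquiv]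

/-- The data of one step other than the unit vector are gathered into the eigenvalue and the last
columns of the block matrix. -/
theorem hasJac_gather (k : ℕ) :
    HasJac (fun p : Matrix (Fin k) (Fin k) ℂ × (Sphere k × (ℂ × (Fin k → ℂ))) =>
      ((p.2.1, (p.2.2.1, Fin.cons (star p.2.2.2) p.1)) :
        Sphere k × (ℂ × (Fin (k + 1) → Fin k → ℂ)))) (fun _ => 1) := by
  have hcons : MeasurePreserving (fun p : (Fin k → Fin k → ℂ) × (Fin k → ℂ) =>
      (Fin.cons (star p.2) p.1 : Fin (k + 1) → Fin k → ℂ)) :=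
    (measurePreserving_cons (A := Fin k → ℂ) k).comp
      (Measure.measurePreserving_swap.comp
        ((MeasurePreserving.id volume).prod (measurePreserving_star k)))
  have h1 : MeasurePreserving
      (fun p : (Fin k → Fin k → ℂ) × (ℂ × (Fin k → ℂ)) =>
      ((p.2.1, Fin.cons (star p.2.2) p.1) : ℂ × (Fin (k + 1) → Fin k → ℂ))) :=
    ((MeasurePreserving.id (volume : Measure ℂ)).prod hcons).comp measurePreserving_prod_leftComm
  have h : MeasurePreserving
      (fun p : (Fin k → Fin k → ℂ) × (Sphere k × (ℂ × (Fin k → ℂ))) =>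
      ((p.2.1, (p.2.2.1, Fin.cons (star p.2.2.2) p.1)) :
        Sphere k × (ℂ × (Fin (k + 1) → Fin k → ℂ)))) :=
    ((MeasurePreserving.id (volume : Measure (Sphere k))).prod h1).comp measurePreserving_prod_leftComm
  refine HasJac.of_measurePreserving
    (f' := fun q => (fun i => q.2.2 i.succ, (q.1, (q.2.1, star (q.2.2 0))))) ?_ ?_ ?_ h
  · rintro ⟨M, u, l, w⟩
    exact Prod.ext rfl (Prod.ext rfl (Prod.ext rfl (star_star w)))
  · rintro ⟨u, l, K⟩
    simp only [star_star]
    congr 2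
    funext i
    refine Fin.cases ?_ (fun j => ?_) i <;> simp
  · have h1 : Measurable fun q : Sphere k × (ℂ × (Fin (k + 1) → Fin k → ℂ)) =>
        (fun i : Fin k => q.2.2 i.succ) := by fun_prop
    have h2 : Measurable fun q : Sphere k × (ℂ × (Fin (k + 1) → Fin k → ℂ)) =>
        star (q.2.2 0) := by fun_prop
    exact h1.prodMk (measurable_fst.prodMk (measurable_snd.fst.prodMk h2))

/-- The matrix with first column `x` and further columns `K`. -/
theorem hasJac_assemble (k : ℕ) :
    HasJac (fun p : (Fin (k + 1) → ℂ) × (Fin (k + 1) → Fin k → ℂ) =>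
      (Matrix.of fun i => Fin.cons (p.1 i) (p.2 i) : Matrix (Fin (k + 1)) (Fin (k + 1)) ℂ))
      (fun _ => 1) := by
  have h1 := (volume_measurePreserving_arrowProdEquivProdArrow ℂ (Fin k → ℂ) (Fin (k + 1))).symm
  have h2 : MeasurePreserving (fun (p : Fin (k + 1) → ℂ × (Fin k → ℂ)) i =>
      (Fin.cons (p i).1 (p i).2 : Fin (k + 1) → ℂ)) :=
    volume_preserving_pi fun _ => measurePreserving_cons k
  have h : MeasurePreserving (fun (p : (Fin (k + 1) → ℂ) × (Fin (k + 1) → Fin k → ℂ)) i =>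
      (Fin.cons (p.1 i) (p.2 i) : Fin (k + 1) → ℂ)) := h2.comp h1
  refine HasJac.of_measurePreserving
    (B := Fin (k + 1) → Fin (k + 1) → ℂ)
    (f' := fun X => (fun i => X i 0, fun i j => X i j.succ)) ?_ ?_ ?_ h
  · rintro ⟨x, K⟩
    simp
  · intro X
    funext i j
    refine Fin.cases ?_ (fun j => ?_) j <;> simp
  · fun_prop

theorem hasJac_cons_prod (k : ℕ) :
    HasJac (fun p : (Fin k → ℂ) × (ℂ × (Fin (k + 1) → Fin k → ℂ)) =>
      ((Fin.cons p.2.1 p.1, p.2.2) : (Fin (k + 1) → ℂ) × (Fin (k + 1) → Fin k → ℂ)))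
      (fun _ => 1) := by
  have h1 : MeasurePreserving (Prod.map (fun p : ℂ × (Fin k → ℂ) =>
      (Fin.cons p.1 p.2 : Fin (k + 1) → ℂ)) (id : (Fin (k + 1) → Fin k → ℂ) → _)) :=
    (measurePreserving_cons k).prod (MeasurePreserving.id volume)
  have h2 : MeasurePreserving (MeasurableEquiv.prodAssoc :
      (ℂ × (Fin k → ℂ)) × (Fin (k + 1) → Fin k → ℂ) ≃ᵐ _) := volume_preserving_prodAssoc
  have h : MeasurePreserving (fun p : (Fin k → ℂ) × (ℂ × (Fin (k + 1) → Fin k → ℂ)) =>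
      ((Fin.cons p.2.1 p.1, p.2.2) : (Fin (k + 1) → ℂ) × (Fin (k + 1) → Fin k → ℂ))) :=
    (h1.comp (h2.symm _)).comp measurePreserving_prod_leftComm
  refine HasJac.of_measurePreserving
    (f' := fun q => (fun i => q.1 i.succ, (q.1 0, q.2))) ?_ ?_ ?_ h
  · rintro ⟨z, l, K⟩
    simp
  · rintro ⟨y, K⟩
    simp only [Prod.mk.injEq, and_true]
    funext i
    refine Fin.cases ?_ (fun j => ?_) i <;> simp
  · fun_prop

/-- Left and right multiplication, on matrices of `k + 1` rows and `k` columns. -/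
def mulLeftRight {k : ℕ} (R : Matrix (Fin (k + 1)) (Fin (k + 1)) ℂ) (S : Matrix (Fin k) (Fin k) ℂ) :
    (Fin (k + 1) → Fin k → ℂ) →ₗ[ℂ] (Fin (k + 1) → Fin k → ℂ) where
  toFun K := fun i j => (R * Matrix.of K * S) i j
  map_add' K K' := by
    funext i j
    change (R * (Matrix.of K + Matrix.of K') * S) i j = _
    rw [Matrix.mul_add, Matrix.add_mul]
    rfl
  map_smul' c K := by
    funext i j
    change (R * (c • Matrix.of K) * S) i j = _
    rw [Matrix.mul_smul, Matrix.smul_mul]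
    rfl

theorem mulLeftRight_apply {k : ℕ} (R : Matrix (Fin (k + 1)) (Fin (k + 1)) ℂ)
    (S : Matrix (Fin k) (Fin k) ℂ) (K : Fin (k + 1) → Fin k → ℂ) :
    Matrix.of (mulLeftRight R S K) = R * Matrix.of K * S := rfl

theorem mulLeftRight_mulLeftRight {k : ℕ} (R R' : Matrix (Fin (k + 1)) (Fin (k + 1)) ℂ)
    (S S' : Matrix (Fin k) (Fin k) ℂ) (K : Fin (k + 1) → Fin k → ℂ) :
    mulLeftRight R S (mulLeftRight R' S' K) = mulLeftRight (R * R') (S' * S) K := by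
  apply Matrix.of.injective
  simp only [mulLeftRight_apply, Matrix.mul_assoc]

theorem mulLeftRight_one {k : ℕ} (K : Fin (k + 1) → Fin k → ℂ) :
    mulLeftRight (1 : Matrix (Fin (k + 1)) (Fin (k + 1)) ℂ) 1 K = K := by
  apply Matrix.of.injective
  rw [mulLeftRight_apply, Matrix.one_mul, Matrix.mul_one]

/-- Left multiplication by an involution has determinant of modulus one, and right multiplication
acts on each of the `k + 1` rows. -/
theorem norm_det_mulLeftRight {k : ℕ} (R : Matrix (Fin (k + 1)) (Fin (k + 1)) ℂ) (hR : R * R = 1)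
    (S : Matrix (Fin k) (Fin k) ℂ) :
    ‖LinearMap.det (mulLeftRight R S)‖ = ‖S.det‖ ^ (k + 1) := by
  have h1 : mulLeftRight R S = mulLeftRight R 1 ∘ₗ mulLeftRight 1 S := by
    refine LinearMap.ext fun K => ?_
    rw [LinearMap.comp_apply, mulLeftRight_mulLeftRight, Matrix.mul_one, Matrix.mul_one]
  have h2 : mulLeftRight R (1 : Matrix (Fin k) (Fin k) ℂ) ∘ₗ mulLeftRight R 1 = LinearMap.id := by
    refine LinearMap.ext fun K => ?_
    rw [LinearMap.comp_apply, mulLeftRight_mulLeftRight, hR, Matrix.mul_one, mulLeftRight_one]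
    rfl
  have h3 : ‖LinearMap.det (mulLeftRight R (1 : Matrix (Fin k) (Fin k) ℂ))‖ = 1 := by
    have h := congrArg LinearMap.det h2
    rw [LinearMap.det_comp, LinearMap.det_id] at h
    rcases mul_self_eq_one_iff.1 h with h | h <;> rw [h] <;> simp
  -- right multiplication acts on each row separately
  have h4 : mulLeftRight (1 : Matrix (Fin (k + 1)) (Fin (k + 1)) ℂ) S =
      LinearMap.pi fun i => (Matrix.toLin' S.transpose).comp (LinearMap.proj i) := by
    refine LinearMap.ext fun K => funext fun i => ?_
    simp only [LinearMap.pi_apply, LinearMap.comp_apply, LinearMap.proj_apply,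
      Matrix.toLin'_apply, Matrix.mulVec_transpose]
    change ((1 : Matrix (Fin (k + 1)) (Fin (k + 1)) ℂ) * Matrix.of K * S) i = _
    rw [Matrix.one_mul]
    rfl
  rw [h1, LinearMap.det_comp, norm_mul, h3, one_mul, h4, LinearMap.det_pi]
  simp

theorem measurable_householder (k : ℕ) (i j : Fin (k + 1)) :
    Measurable fun u : Sphere k => householder u i j := by
  have hu : ∀ i, Measurable fun u : Sphere k => (e1 k - u.1) i := fun i =>
    ((measurable_pi_apply i).comp ((measurable_const (a := e1 k)).sub (measurable_sphere_val k)))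
  have hn : Measurable fun u : Sphere k => (l2norm (e1 k - u.1) : ℂ) :=
    Complex.measurable_ofReal.comp (measurable_l2norm.comp
      ((measurable_const (a := e1 k)).sub (measurable_sphere_val k)))
  have : (fun u : Sphere k => householder u i j) = fun u =>
      (1 : Matrix (Fin (k + 1)) (Fin (k + 1)) ℂ) i j -
        2 / (l2norm (e1 k - u.1) : ℂ) ^ 2 * ((e1 k - u.1) i * star ((e1 k - u.1) j)) := rfl
  rw [this]
  have h1 := hu i
  have h2 := hu j
  fun_prop

theorem measurable_householderBlockInv (k : ℕ) (i j : Fin k) :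
    Measurable fun u : Sphere k => householderBlockInv u i j := by
  have hu : ∀ i, Measurable fun u : Sphere k => u.1 i := fun i =>
    (measurable_pi_apply i).comp (measurable_sphere_val k)
  have : (fun u : Sphere k => householderBlockInv u i j) = fun u =>
      (1 : Matrix (Fin k) (Fin k) ℂ) i j -
        1 / ((1 - u.1 0) * u.1 0) * (u.1 i.succ * star (u.1 j.succ)) := rfl
  rw [this]
  have h0 := hu 0
  have h1 := hu i.succ
  have h2 := hu j.succ
  exact measurable_const.sub ((measurable_const.div ((measurable_const.sub h0).mul h0)).mul
    (h1.mul (continuous_star.measurable.comp h2)))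

/-- The last columns of the conjugate, by the reflection, of the matrix with first column `lam e1`
and last columns `K`. -/
def conjColumns {k : ℕ} (u : Sphere k) (lam : ℂ) (K : Fin (k + 1) → Fin k → ℂ) :
    Fin (k + 1) → Fin k → ℂ :=
  fun i j => lam * (householder u i 0 * householder u 0 j.succ) +
    mulLeftRight (householder u) (householderBlock u) K i j

/-- For fixed `u` and `lam`, `conjColumns` is an affine bijection, and its linear part has complex
determinant of modulus `|u 0| ^ (k + 1)`. -/
theorem hasJac_conjColumns (k : ℕ) :
    HasJac (fun p : Sphere k × (ℂ × (Fin (k + 1) → Fin k → ℂ)) =>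
      (p.1, (p.2.1, conjColumns p.1 p.2.1 p.2.2)))
      (fun p => ENNReal.ofReal (‖p.1.1 0‖ ^ (2 * (k + 1)))) := by
  have hinv1 : ∀ (u : Sphere k) K, mulLeftRight (householder u) (householderBlockInv u)
      (mulLeftRight (householder u) (householderBlock u) K) = K := by
    intro u K
    rw [mulLeftRight_mulLeftRight, householder_mul_self, householderBlock_mul_inv,
      mulLeftRight_one]
  have hinv2 : ∀ (u : Sphere k) K, mulLeftRight (householder u) (householderBlock u)
      (mulLeftRight (householder u) (householderBlockInv u) K) = K := by
    intro u K
    rw [mulLeftRight_mulLeftRight, householder_mul_self, householderBlock_inv_mul,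
      mulLeftRight_one]
  have hmeas : ∀ S : Sphere k → Matrix (Fin k) (Fin k) ℂ, (∀ i j, Measurable fun u => S u i j) →
      ∀ K : Sphere k × (ℂ × (Fin (k + 1) → Fin k → ℂ)) → Fin (k + 1) → Fin k → ℂ, Measurable K →
      Measurable fun p => mulLeftRight (householder p.1) (S p.1) (K p) := by
    intro S hS K hK
    refine measurable_pi_lambda _ fun i => measurable_pi_lambda _ fun j => ?_
    have h1 : (fun p => mulLeftRight (householder p.1) (S p.1) (K p) i j) = fun p =>
        ∑ b, (∑ a, householder p.1 i a * K p a b) * S p.1 b j := by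
      funext p
      change (householder p.1 * Matrix.of (K p) * S p.1) i j = _
      simp only [Matrix.mul_apply, Matrix.of_apply]
    rw [h1]
    refine Finset.measurable_sum _ fun b _ => Measurable.mul
      (Finset.measurable_sum _ fun a _ => Measurable.mul ?_ ?_) ?_
    · exact (measurable_householder k i a).comp measurable_fst
    · exact (measurable_pi_apply b).comp ((measurable_pi_apply a).comp hK)
    · exact (hS b j).comp measurable_fst
  have hshift : Measurable fun p : Sphere k × (ℂ × (Fin (k + 1) → Fin k → ℂ)) =>
      (fun i j => p.2.1 * (householder p.1 i 0 * householder p.1 0 j.succ) :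
        Fin (k + 1) → Fin k → ℂ) := by
    refine measurable_pi_lambda _ fun i => measurable_pi_lambda _ fun j => ?_
    refine measurable_snd.fst.mul (Measurable.mul ?_ ?_)
    · exact (measurable_householder k i 0).comp measurable_fst
    · exact (measurable_householder k 0 j.succ).comp measurable_fst
  have hf : Measurable fun p : Sphere k × (ℂ × (Fin (k + 1) → Fin k → ℂ)) =>
      (p.1, (p.2.1, conjColumns p.1 p.2.1 p.2.2)) :=
    measurable_fst.prodMk (measurable_snd.fst.prodMk (hshift.add
      (hmeas _ (fun i j => measurable_householder k i.succ j.succ) _ measurable_snd.snd)))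
  have hf' : Measurable fun p : Sphere k × (ℂ × (Fin (k + 1) → Fin k → ℂ)) =>
      (p.1, (p.2.1, mulLeftRight (householder p.1) (householderBlockInv p.1)
        (p.2.2 - fun i j => p.2.1 * (householder p.1 i 0 * householder p.1 0 j.succ)))) :=
    measurable_fst.prodMk (measurable_snd.fst.prodMk
      (hmeas _ (measurable_householderBlockInv k) _ (measurable_snd.snd.sub hshift)))
  have hJ : Measurable fun p : Sphere k × (ℂ × (Fin (k + 1) → Fin k → ℂ)) =>
      ENNReal.ofReal (‖p.1.1 0‖ ^ (2 * (k + 1))) := by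
    have : Measurable fun p : Sphere k × (ℂ × (Fin (k + 1) → Fin k → ℂ)) => p.1.1 0 :=
      ((measurable_pi_apply 0).comp (measurable_sphere_val k)).comp measurable_fst
    exact (this.norm.pow_const _).ennreal_ofReal
  have hl : Function.LeftInverse
      (fun p : Sphere k × (ℂ × (Fin (k + 1) → Fin k → ℂ)) =>
        (p.1, (p.2.1, mulLeftRight (householder p.1) (householderBlockInv p.1)
          (p.2.2 - fun i j => p.2.1 * (householder p.1 i 0 * householder p.1 0 j.succ)))))
      (fun p => (p.1, (p.2.1, conjColumns p.1 p.2.1 p.2.2))) := by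
    rintro ⟨u, l, K⟩
    have h1 : conjColumns u l K - (fun i j => l * (householder u i 0 * householder u 0 j.succ)) =
        mulLeftRight (householder u) (householderBlock u) K := by
      funext i j; simp [conjColumns]
    simp only [h1, hinv1]
  refine HasJac.of_inverse hl ?_ hf hf' hJ ?_
  · rintro ⟨u, l, K⟩
    simp only [Prod.mk.injEq, true_and]
    funext i j
    simp only [conjColumns, hinv2, Pi.sub_apply]
    ring
  · intro g hg
    have h1 : ∀ p : Sphere k × (ℂ × (Fin (k + 1) → Fin k → ℂ)), g p =
        (fun q => g (q.1, (q.2.1, mulLeftRight (householder q.1) (householderBlockInv q.1)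
          (q.2.2 - fun i j => q.2.1 * (householder q.1 i 0 * householder q.1 0 j.succ)))))
          (p.1, (p.2.1, conjColumns p.1 p.2.1 p.2.2)) := fun p => by
      conv_lhs => rw [← hl p]
    rw [lintegral_congr fun p => congrArg (· * _) (h1 p)]
    set G := (fun q : Sphere k × (ℂ × (Fin (k + 1) → Fin k → ℂ)) =>
        g (q.1, (q.2.1, mulLeftRight (householder q.1) (householderBlockInv q.1)
          (q.2.2 - fun i j => q.2.1 * (householder q.1 i 0 * householder q.1 0 j.succ))))) with hG
    have hGm : Measurable G := hg.comp hf'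
    have hI : Measurable fun p : Sphere k × (ℂ × (Fin (k + 1) → Fin k → ℂ)) =>
        G (p.1, (p.2.1, conjColumns p.1 p.2.1 p.2.2)) *
          ENNReal.ofReal (‖p.1.1 0‖ ^ (2 * (k + 1))) := (hGm.comp hf).mul hJ
    refine (lintegral_prod _ hI.aemeasurable).trans
      (Eq.trans ?_ (lintegral_prod _ hGm.aemeasurable).symm)
    refine lintegral_congr fun u => ?_
    refine (lintegral_prod _ (hI.comp measurable_prodMk_left).aemeasurable).trans
      (Eq.trans ?_ (lintegral_prod _ (hGm.comp measurable_prodMk_left).aemeasurable).symm)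
    refine lintegral_congr fun l => ?_
    have hdet : ‖LinearMap.det (mulLeftRight (householder u) (householderBlock u))‖ ^ 2 =
        ‖u.1 0‖ ^ (2 * (k + 1)) := by
      rw [norm_det_mulLeftRight _ (householder_mul_self u), det_householderBlock, norm_neg,
        ← pow_mul, mul_comm 2]
    have hdet0 : LinearMap.det (mulLeftRight (householder u) (householderBlock u)) ≠ 0 := by
      rw [← norm_ne_zero_iff, norm_det_mulLeftRight _ (householder_mul_self u),
        det_householderBlock, norm_neg]
      exact pow_ne_zero _ (norm_ne_zero_iff.2 (sphere_ne_zero u))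
    have hGl : Measurable fun K : Fin (k + 1) → Fin k → ℂ => G (u, (l, K)) :=
      hGm.comp (measurable_prodMk_left.comp measurable_prodMk_left)
    have h2 := lintegral_comp_complex_linearMap
      (mulLeftRight (householder u) (householderBlock u)) hdet0
      (h := fun K => G (u, (l, (fun i j => l * (householder u i 0 * householder u 0 j.succ)) + K)))
      (hGl.comp (measurable_const_add _))
    rw [lintegral_add_left_eq_self (fun K => G (u, (l, K))), hdet] at h2
    exact h2

/-! ### The Jacobian of one step -/

/-- The first column of the matrix with last columns `K` for which `lam` is an eigenvalue with
eigenvector of affine coordinate `z`, where `y = (lam, z)`. -/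
def firstColumn {k : ℕ} (y : Fin (k + 1) → ℂ) (K : Fin (k + 1) → Fin k → ℂ) : Fin (k + 1) → ℂ :=
  fun i => y 0 * affinePoint (fun j => y j.succ) i - ∑ j, K i j * y j.succ

/-- The derivative of `firstColumn` in its first argument. -/
def firstColumnJacobian {k : ℕ} (y : Fin (k + 1) → ℂ) (K : Fin (k + 1) → Fin k → ℂ) :
    Matrix (Fin (k + 1)) (Fin (k + 1)) ℂ :=
  Matrix.of fun i => Fin.cons (affinePoint (fun j => y j.succ) i) fun j : Fin k =>
    y 0 * (1 : Matrix (Fin (k + 1)) (Fin (k + 1)) ℂ) i j.succ - K i j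

instance (n k m : ℕ) :
    (volume : Measure ((Fin m → ℂ) × (Fin n → Fin k → ℂ))).IsAddHaarMeasure :=
  have : (volume : Measure (Fin n → Fin k → ℂ)).IsAddHaarMeasure :=
    Measure.pi.isAddHaarMeasure fun _ : Fin n => (volume : Measure (Fin k → ℂ))
  Measure.prod.instIsAddHaarMeasure (volume : Measure (Fin m → ℂ))
    (volume : Measure (Fin n → Fin k → ℂ))

/-- The product of a matrix with a fixed vector, as a linear map of the matrix. -/
def mulVecRight {k : ℕ} (z : Fin k → ℂ) : (Fin (k + 1) → Fin k → ℂ) →ₗ[ℂ] (Fin (k + 1) → ℂ) where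
  toFun K i := ∑ j, K i j * z j
  map_add' K K' := by
    funext i
    simp [add_mul, Finset.sum_add_distrib]
  map_smul' c K := by
    funext i
    simp [Finset.mul_sum, mul_assoc]

/-- The derivative of `(y, K) ↦ (firstColumn y K, K)`. -/
def firstColumnFDeriv {k : ℕ} (p : (Fin (k + 1) → ℂ) × (Fin (k + 1) → Fin k → ℂ)) :
    ((Fin (k + 1) → ℂ) × (Fin (k + 1) → Fin k → ℂ)) →ₗ[ℂ]
      ((Fin (k + 1) → ℂ) × (Fin (k + 1) → Fin k → ℂ)) :=
  ((Matrix.toLin' (firstColumnJacobian p.1 p.2)).comp (LinearMap.fst ℂ _ _) -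
    (mulVecRight fun j => p.1 j.succ).comp (LinearMap.snd ℂ _ _)).prod (LinearMap.snd ℂ _ _)

theorem firstColumnFDeriv_fst {k : ℕ} (p d : (Fin (k + 1) → ℂ) × (Fin (k + 1) → Fin k → ℂ))
    (i : Fin (k + 1)) : (firstColumnFDeriv p d).1 i =
      affinePoint (fun j => p.1 j.succ) i * d.1 0 +
        ∑ j : Fin k, (p.1 0 * (1 : Matrix (Fin (k + 1)) (Fin (k + 1)) ℂ) i j.succ - p.2 i j) *
          d.1 j.succ - ∑ j, d.2 i j * p.1 j.succ := by
  change ((firstColumnJacobian p.1 p.2).mulVec d.1) i - _ = _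
  rw [Matrix.mulVec, dotProduct, Fin.sum_univ_succ]
  rfl

/-- The determinant of a block triangular linear map with identity as one diagonal block. -/
theorem det_prod_snd {V W : Type*} [AddCommGroup V] [Module ℂ V] [FiniteDimensional ℂ V]
    [AddCommGroup W] [Module ℂ W] [FiniteDimensional ℂ W] (A : V →ₗ[ℂ] V) (B : W →ₗ[ℂ] V) :
    LinearMap.det ((A.comp (LinearMap.fst ℂ V W) - B.comp (LinearMap.snd ℂ V W)).prod
      (LinearMap.snd ℂ V W)) = LinearMap.det A := by
  let b := Module.Free.chooseBasis ℂ V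
  let c := Module.Free.chooseBasis ℂ W
  rw [← LinearMap.det_toMatrix (b.prod c), ← LinearMap.det_toMatrix b]
  have : LinearMap.toMatrix (b.prod c) (b.prod c)
      ((A.comp (LinearMap.fst ℂ V W) - B.comp (LinearMap.snd ℂ V W)).prod
        (LinearMap.snd ℂ V W)) =
      Matrix.fromBlocks (LinearMap.toMatrix b b A) (-LinearMap.toMatrix c b B) 0 1 := by
    ext i j
    rcases i with i | i <;> rcases j with j | j <;>
      simp [LinearMap.toMatrix_apply, Matrix.one_apply, Finsupp.single_apply, eq_comm]
  rw [this, Matrix.det_fromBlocks_zero₂₁, Matrix.det_one, mul_one]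

theorem det_firstColumnFDeriv {k : ℕ} (p : (Fin (k + 1) → ℂ) × (Fin (k + 1) → Fin k → ℂ)) :
    LinearMap.det (firstColumnFDeriv p) = (firstColumnJacobian p.1 p.2).det := by
  rw [firstColumnFDeriv, det_prod_snd, LinearMap.det_toLin']

theorem hasFDerivAt_firstColumn {k : ℕ}
    (p : (Fin (k + 1) → ℂ) × (Fin (k + 1) → Fin k → ℂ)) :
    HasFDerivAt (fun q : (Fin (k + 1) → ℂ) × (Fin (k + 1) → Fin k → ℂ) =>
      (firstColumn q.1 q.2, q.2)) (LinearMap.toContinuousLinearMap (firstColumnFDeriv p)) p := by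
  let cy (i : Fin (k + 1)) : ((Fin (k + 1) → ℂ) × (Fin (k + 1) → Fin k → ℂ)) →L[ℂ] ℂ :=
    (ContinuousLinearMap.proj (φ := fun _ : Fin (k + 1) => ℂ) i).comp
      (ContinuousLinearMap.fst ℂ (Fin (k + 1) → ℂ) (Fin (k + 1) → Fin k → ℂ))
  let cK (i : Fin (k + 1)) (j : Fin k) :
      ((Fin (k + 1) → ℂ) × (Fin (k + 1) → Fin k → ℂ)) →L[ℂ] ℂ :=
    (ContinuousLinearMap.proj (φ := fun _ : Fin k => ℂ) j).comp
      ((ContinuousLinearMap.proj (φ := fun _ : Fin (k + 1) => Fin k → ℂ) i).comp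
        (ContinuousLinearMap.snd ℂ (Fin (k + 1) → ℂ) (Fin (k + 1) → Fin k → ℂ)))
  have hy : ∀ i, HasFDerivAt
      (fun q : (Fin (k + 1) → ℂ) × (Fin (k + 1) → Fin k → ℂ) => q.1 i) (cy i) p :=
    fun i => (cy i).hasFDerivAt
  have hK : ∀ i j, HasFDerivAt
      (fun q : (Fin (k + 1) → ℂ) × (Fin (k + 1) → Fin k → ℂ) => q.2 i j) (cK i j) p :=
    fun i j => (cK i j).hasFDerivAt
  have h1 : HasFDerivAt (fun q : (Fin (k + 1) → ℂ) × (Fin (k + 1) → Fin k → ℂ) =>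
      firstColumn q.1 q.2) ((ContinuousLinearMap.fst ℂ _ _).comp
        (LinearMap.toContinuousLinearMap (firstColumnFDeriv p))) p := by
    rw [hasFDerivAt_pi']
    intro i
    have hsum := HasFDerivAt.fun_sum (u := Finset.univ) fun j _ => (hK i j).mul (hy j.succ)
    have hsum' : ∀ d : (Fin (k + 1) → ℂ) × (Fin (k + 1) → Fin k → ℂ),
        (∑ j, (p.2 i j • cy j.succ + p.1 j.succ • cK i j)) d =
          ∑ j, p.2 i j * d.1 j.succ + ∑ j, d.2 i j * p.1 j.succ := by
      intro d
      rw [sum_apply, ← Finset.sum_add_distrib]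
      refine Finset.sum_congr rfl fun j _ => ?_
      change p.2 i j * d.1 j.succ + p.1 j.succ * d.2 i j = _
      ring
    revert hsum hsum'
    refine Fin.cases ?_ (fun l => ?_) i <;> intro hsum hsum'
    · have h2 := (hy 0).sub hsum
      have h3 : (fun q : (Fin (k + 1) → ℂ) × (Fin (k + 1) → Fin k → ℂ) => firstColumn q.1 q.2 0) =
          fun q => q.1 0 - ∑ j, q.2 0 j * q.1 j.succ := by
        funext q; simp [firstColumn, affinePoint]
      rw [h3]
      refine h2.congr_fderiv (ContinuousLinearMap.ext fun d => ?_)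
      rw [sub_apply, hsum']
      change d.1 0 - _ = (firstColumnFDeriv p d).1 0
      rw [firstColumnFDeriv_fst]
      simp only [affinePoint, Fin.cons_zero, Matrix.one_apply, (Fin.succ_ne_zero _).symm, if_false,
        mul_zero, zero_sub, neg_mul, Finset.sum_neg_distrib]
      ring
    · have h2 := ((hy 0).mul (hy l.succ)).sub hsum
      have h3 : (fun q : (Fin (k + 1) → ℂ) × (Fin (k + 1) → Fin k → ℂ) =>
          firstColumn q.1 q.2 l.succ) =
          fun q => q.1 0 * q.1 l.succ - ∑ j, q.2 l.succ j * q.1 j.succ := by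
        funext q; simp [firstColumn, affinePoint]
      rw [h3]
      refine h2.congr_fderiv (ContinuousLinearMap.ext fun d => ?_)
      rw [sub_apply, hsum']
      change p.1 0 * d.1 l.succ + p.1 l.succ * d.1 0 - _ = (firstColumnFDeriv p d).1 l.succ
      rw [firstColumnFDeriv_fst]
      simp only [affinePoint, Fin.cons_succ, Matrix.one_apply, Fin.succ_inj, sub_mul,
        Finset.sum_sub_distrib, mul_ite, mul_one, mul_zero, ite_mul, zero_mul, Finset.sum_ite_eq,
        Finset.mem_univ, if_true]
      ring
  exact h1.prodMk (ContinuousLinearMap.snd ℂ _ _).hasFDerivAt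

theorem hasJac_firstColumn (k : ℕ) :
    HasJac (fun q : (Fin (k + 1) → ℂ) × (Fin (k + 1) → Fin k → ℂ) => (firstColumn q.1 q.2, q.2))
      (fun q => ENNReal.ofReal (‖(firstColumnJacobian q.1 q.2).det‖ ^ 2)) := by
  have hdet : ∀ p : (Fin (k + 1) → ℂ) × (Fin (k + 1) → Fin k → ℂ),
      ((LinearMap.toContinuousLinearMap (firstColumnFDeriv p)).restrictScalars ℝ).det =
        ‖(firstColumnJacobian p.1 p.2).det‖ ^ 2 := by
    intro p
    change LinearMap.det ((firstColumnFDeriv p).restrictScalars ℝ) = _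
    rw [LinearMap.det_restrictScalars, Algebra.norm_complex_apply, Complex.normSq_eq_norm_sq,
      det_firstColumnFDeriv]
  have hmeas : Measurable fun q : (Fin (k + 1) → ℂ) × (Fin (k + 1) → Fin k → ℂ) =>
      ‖(firstColumnJacobian q.1 q.2).det‖ ^ 2 := by
    have hc : Continuous fun q : (Fin (k + 1) → ℂ) × (Fin (k + 1) → Fin k → ℂ) =>
        firstColumnJacobian q.1 q.2 := by
      refine continuous_matrix fun i j => ?_
      refine Fin.cases ?_ (fun j => ?_) j
      · simp only [firstColumnJacobian, Matrix.of_apply, Fin.cons_zero]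
        fun_prop
      · simp only [firstColumnJacobian, Matrix.of_apply, Fin.cons_succ]
        fun_prop
    exact (hc.matrix_det.norm.pow 2).measurable
  refine (HasJac.of_hasFDerivAt
    (fun p => (hasFDerivAt_firstColumn p).restrictScalars ℝ) ?_).congr fun p => ?_
  · simp_rw [hdet]; exact hmeas
  · rw [hdet, abs_of_nonneg (by positivity)]

theorem stepR_succ {k : ℕ} (lam : ℂ) (u : Sphere k) (w : Fin k → ℂ)
    (M : Matrix (Fin k) (Fin k) ℂ) (i : Fin (k + 1)) (j : Fin k) :
    stepR lam u w M i j.succ = conjColumns u lam (Fin.cons (star w) M) i j := by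
  change _ = lam * (householder u i 0 * householder u 0 j.succ) +
    (householder u * Matrix.of (Fin.cons (star w) M : Fin (k + 1) → Fin k → ℂ) *
      householderBlock u) i j
  have h0 : ∀ l, (householder u * blockR lam w M) l 0 = lam * householder u l 0 := by
    intro l
    rw [Matrix.mul_apply, Fin.sum_univ_succ]
    simp [blockR, mul_comm]
  have h1 : ∀ l (c : Fin k), (householder u * blockR lam w M) l c.succ =
      (householder u * Matrix.of (Fin.cons (star w) M : Fin (k + 1) → Fin k → ℂ)) l c := by
    intro l c
    rw [Matrix.mul_apply, Matrix.mul_apply]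
    refine Finset.sum_congr rfl fun a _ => ?_
    congr 1
    exact Fin.cases rfl (fun a => rfl) a
  rw [stepR, Matrix.mul_apply, Fin.sum_univ_succ, h0, Matrix.mul_apply]
  simp_rw [h1]
  rw [mul_assoc]
  rfl

/-- A step for a right eigenvector in affine coordinates: the first column of the matrix is determined
by the eigenvector equation. -/
theorem stepR_eq {k : ℕ} (lam : ℂ) (u : Sphere k) (w : Fin k → ℂ)
    (M : Matrix (Fin k) (Fin k) ℂ) :
    stepR lam u w M = Matrix.of fun i => Fin.cons
      (firstColumn (Fin.cons lam (chart u.1)) (conjColumns u lam (Fin.cons (star w) M)) i)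
      (conjColumns u lam (Fin.cons (star w) M) i) := by
  ext i j
  refine Fin.cases ?_ (fun j => ?_) j
  · have h := congrFun (stepR_mulVec_affinePoint lam u w M) i
    rw [Matrix.mulVec, dotProduct, Fin.sum_univ_succ] at h
    simp_rw [stepR_succ] at h
    simp only [Matrix.of_apply, Fin.cons_zero, firstColumn, Fin.cons_succ]
    simp only [affinePoint, Fin.cons_zero, Fin.cons_succ, mul_one, Pi.smul_apply,
      smul_eq_mul] at h ⊢
    linear_combination h
  · rw [stepR_succ]
    rfl

theorem det_firstColumnJacobian {k : ℕ} (lam : ℂ) (u : Sphere k) (w : Fin k → ℂ)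
    (M : Matrix (Fin k) (Fin k) ℂ) :
    (firstColumnJacobian (Fin.cons lam (chart u.1))
      (conjColumns u lam (Fin.cons (star w) M))).det = (Matrix.scalar (Fin k) lam - M).det := by
  rw [← det_affine_column lam u w M]
  congr 1
  ext i j
  refine Fin.cases ?_ (fun j => ?_) j
  · simp [firstColumnJacobian]
  · simp only [firstColumnJacobian, Matrix.of_apply, Fin.cons_succ, Fin.cons_zero,
      Matrix.sub_apply, Matrix.smul_apply, smul_eq_mul, stepR_succ]

/-- The Jacobian of one step for a right eigenvector. The density of the volume of lines in the
affine coordinate compensates the Jacobian of the conjugation by the reflection. -/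
theorem hasJac_stepR (k : ℕ) :
    HasJac (fun p : Matrix (Fin k) (Fin k) ℂ × (Sphere k × (ℂ × (Fin k → ℂ))) =>
      stepR p.2.2.1 p.2.1 p.2.2.2 p.1)
      (fun p => ENNReal.ofReal (‖(Matrix.scalar (Fin k) p.2.2.1 - p.1).det‖ ^ 2)) := by
  have h3 := (hasJac_chart k).prodMap_id (Ω := ℂ × (Fin (k + 1) → Fin k → ℂ)) fun _ =>
    ENNReal.ofReal_ne_top
  have h := (hasJac_assemble k).comp ((hasJac_firstColumn k).comp ((hasJac_cons_prod k).comp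
    (h3.comp ((hasJac_conjColumns k).comp (hasJac_gather k)))))
  have heq : (fun p : Matrix (Fin k) (Fin k) ℂ × (Sphere k × (ℂ × (Fin k → ℂ))) =>
      stepR p.2.2.1 p.2.1 p.2.2.2 p.1) = _ := funext fun p => stepR_eq p.2.2.1 p.2.1 p.2.2.2 p.1
  rw [heq]
  refine h.congr fun p => ?_
  obtain ⟨M, u, lam, w⟩ := p
  have hw : ENNReal.ofReal ((‖u.1 0‖ ^ (2 * (k + 1)))⁻¹) *
      ENNReal.ofReal (‖u.1 0‖ ^ (2 * (k + 1))) = 1 := by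
    have : 0 < ‖u.1 0‖ := norm_pos_iff.2 (sphere_ne_zero u)
    rw [← ENNReal.ofReal_mul (by positivity), inv_mul_cancel₀ (by positivity), ENNReal.ofReal_one]
  simp only [Function.comp, Prod.map, id, mul_one, one_mul]
  rw [hw, mul_one, ← det_firstColumnJacobian lam u w M]

/-- Left eigenvectors are right eigenvectors of the adjoint. -/
theorem stepL_eq {k : ℕ} (lam : ℂ) (v : Sphere k) (w : Fin k → ℂ)
    (M : Matrix (Fin k) (Fin k) ℂ) :
    stepL lam v w M = (stepR (star lam) v w M.conjTranspose).conjTranspose := by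
  have h1 : (householder v).conjTranspose = householder v := by
    rw [householder, Matrix.conjTranspose_sub, Matrix.conjTranspose_one,
      Matrix.conjTranspose_smul, Matrix.conjTranspose_vecMulVec, star_star]
    congr 2
    simp
  have h2 : (blockR (star lam) w M.conjTranspose).conjTranspose = blockL lam w M := by
    ext i j
    refine Fin.cases ?_ (fun i => ?_) i <;> refine Fin.cases ?_ (fun j => ?_) j <;>
      simp [blockR, blockL]
  rw [stepR, Matrix.conjTranspose_mul, Matrix.conjTranspose_mul, h1, h2, stepL, Matrix.mul_assoc]

theorem conjTranspose_scalar_sub {k : ℕ} (t : ℂ) (M : Matrix (Fin k) (Fin k) ℂ) :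
    (Matrix.scalar (Fin k) t - M).conjTranspose =
      Matrix.scalar (Fin k) (star t) - M.conjTranspose := by
  rw [Matrix.conjTranspose_sub]
  congr 1
  ext i j
  by_cases hij : i = j <;> simp [hij, eq_comm]

theorem hasJac_stepL (k : ℕ) :
    HasJac (fun p : Matrix (Fin k) (Fin k) ℂ × (Sphere k × (ℂ × (Fin k → ℂ))) =>
      stepL p.2.2.1 p.2.1 p.2.2.2 p.1)
      (fun p => ENNReal.ofReal (‖(Matrix.scalar (Fin k) p.2.2.1 - p.1).det‖ ^ 2)) := by
  have hstar : HasJac (Matrix.conjTranspose : Matrix (Fin (k + 1)) (Fin (k + 1)) ℂ → _)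
      (fun _ => 1) :=
    HasJac.of_measurePreserving Matrix.conjTranspose_conjTranspose
      Matrix.conjTranspose_conjTranspose (measurePreserving_conjTranspose _).measurable
      (measurePreserving_conjTranspose _)
  have hpre : HasJac (fun p : Matrix (Fin k) (Fin k) ℂ × (Sphere k × (ℂ × (Fin k → ℂ))) =>
      (p.1.conjTranspose, (p.2.1, (star p.2.2.1, p.2.2.2)))) (fun _ => 1) := by
    have hinv : Function.Involutive
        (fun p : Matrix (Fin k) (Fin k) ℂ × (Sphere k × (ℂ × (Fin k → ℂ))) =>
          (p.1.conjTranspose, (p.2.1, (star p.2.2.1, p.2.2.2)))) := by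
      rintro ⟨M, u, l, w⟩
      simp
    have hmp : MeasurePreserving
        (fun p : Matrix (Fin k) (Fin k) ℂ × (Sphere k × (ℂ × (Fin k → ℂ))) =>
          (p.1.conjTranspose, (p.2.1, (star p.2.2.1, p.2.2.2)))) :=
      (measurePreserving_conjTranspose k).prod
        ((MeasurePreserving.id volume).prod
          (measurePreserving_conj.prod (MeasurePreserving.id volume)))
    exact HasJac.of_measurePreserving hinv.leftInverse hinv.rightInverse hmp.measurable hmp
  have h := hstar.comp ((hasJac_stepR k).comp hpre)
  have heq : (fun p : Matrix (Fin k) (Fin k) ℂ × (Sphere k × (ℂ × (Fin k → ℂ))) =>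
      stepL p.2.2.1 p.2.1 p.2.2.2 p.1) = _ := funext fun p => stepL_eq p.2.2.1 p.2.1 p.2.2.2 p.1
  rw [heq]
  refine h.congr fun p => ?_
  obtain ⟨M, u, lam, w⟩ := p
  simp only [mul_one, one_mul]
  rw [← conjTranspose_scalar_sub, Matrix.det_conjTranspose, norm_star]

/-! ### Composition of the steps -/

theorem det_block_column {k : ℕ} (A : Matrix (Fin (k + 1)) (Fin (k + 1)) ℂ)
    (h : ∀ i : Fin k, A i.succ 0 = 0) :
    A.det = A 0 0 * (A.submatrix Fin.succ Fin.succ).det := by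
  rw [Matrix.det_succ_column_zero, Fin.sum_univ_succ]
  simp [h]

theorem det_scalar_sub_stepR {k : ℕ} (t lam : ℂ) (u : Sphere k) (w : Fin k → ℂ)
    (M : Matrix (Fin k) (Fin k) ℂ) :
    (Matrix.scalar (Fin (k + 1)) t - stepR lam u w M).det =
      (t - lam) * (Matrix.scalar (Fin k) t - M).det := by
  have hRR := householder_mul_self u
  have h1 : Matrix.scalar (Fin (k + 1)) t - stepR lam u w M =
      householder u * (Matrix.scalar (Fin (k + 1)) t - blockR lam w M) * householder u := by
    have hs : householder u * Matrix.scalar (Fin (k + 1)) t * householder u =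
        Matrix.scalar (Fin (k + 1)) t := by
      rw [← (Matrix.scalar_commute t (fun _ => Commute.all _ _) (householder u)).eq, mul_assoc,
        hRR, mul_one]
    rw [mul_sub, sub_mul, hs, stepR]
  have h2 : (householder u).det * (householder u).det = 1 := by
    rw [← Matrix.det_mul, hRR, Matrix.det_one]
  have h4 := det_block_column (Matrix.scalar (Fin (k + 1)) t - blockR lam w M)
    fun i => by simp [blockR]
  have h3 : (Matrix.scalar (Fin (k + 1)) t - blockR lam w M).submatrix Fin.succ Fin.succ =
      Matrix.scalar (Fin k) t - M := by
    ext i j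
    simp [blockR, Matrix.diagonal_apply]
  have h5 : (Matrix.scalar (Fin (k + 1)) t - blockR lam w M) 0 0 = t - lam := by
    simp [blockR]
  rw [h3, h5] at h4
  rw [h1, Matrix.det_mul, Matrix.det_mul, h4]
  linear_combination (t - lam) * (Matrix.scalar (Fin k) t - M).det * h2

theorem det_scalar_sub_stepL {k : ℕ} (t lam : ℂ) (v : Sphere k) (w : Fin k → ℂ)
    (M : Matrix (Fin k) (Fin k) ℂ) :
    (Matrix.scalar (Fin (k + 1)) t - stepL lam v w M).det =
      (t - lam) * (Matrix.scalar (Fin k) t - M).det := by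
  have h := congrArg star (det_scalar_sub_stepR (star t) (star lam) v w M.conjTranspose)
  rwa [← Matrix.det_conjTranspose, conjTranspose_scalar_sub, ← stepL_eq, star_mul',
    ← Matrix.det_conjTranspose, conjTranspose_scalar_sub, star_star, star_sub, star_star,
    star_star, Matrix.conjTranspose_conjTranspose] at h

/-- The eigenvalues split off at the first `i` steps are roots of the characteristic polynomial. -/
theorem det_scalar_sub_stage {n m : ℕ} (mL : ℕ) (p : Params n m) (t : ℂ) :
    ∀ (i : ℕ) (h : i ≤ m), (Matrix.scalar (Fin (n + i)) t - stage mL p i h).det =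
      (∏ j : Fin i, (t - p.1 (j.castLE h))) * (Matrix.scalar (Fin n) t - p.2.2.2).det
  | 0, h => by
    rw [Fin.prod_univ_zero, one_mul]
    rfl
  | i + 1, h => by
    have ih := det_scalar_sub_stage mL p t i (Nat.le_of_succ_le h)
    rw [Fin.prod_univ_castSucc]
    have h1 : (Matrix.scalar (Fin (n + (i + 1))) t - stage mL p (i + 1) h).det =
        (t - p.1 ⟨i, h⟩) * (Matrix.scalar (Fin (n + i)) t -
          stage mL p i (Nat.le_of_succ_le h)).det := by
      rw [stage]
      split_ifs
      · exact det_scalar_sub_stepL _ _ _ _ _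
      · exact det_scalar_sub_stepR _ _ _ _ _
    rw [h1, ih]
    have h2 : (Fin.last i).castLE h = ⟨i, h⟩ := rfl
    have h3 : ∀ j : Fin i, j.castSucc.castLE h = j.castLE (Nat.le_of_succ_le h) := fun _ => rfl
    simp_rw [h2, h3]
    ring

theorem vandermondeProd_succ {m : ℕ} (lam : Fin (m + 1) → ℂ) :
    vandermondeProd lam = vandermondeProd (fun j => lam (Fin.castSucc j)) *
      ∏ j : Fin m, (lam (Fin.last m) - lam (Fin.castSucc j)) := by
  have h : ∀ {r : ℕ} (i : Fin r) (f : Fin r → ℂ),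
      ∏ j ∈ Finset.Ioi i, f j = ∏ j, if i < j then f j else 1 := fun i f => by
    rw [← Finset.prod_filter]
    congr 1
    ext j; simp
  simp only [vandermondeProd, h]
  rw [Fin.prod_univ_castSucc]
  have h1 : ∀ i : Fin m, (∏ j, if i.castSucc < j then lam j - lam i.castSucc else 1) =
      (∏ j : Fin m, if i < j then lam j.castSucc - lam i.castSucc else 1) *
        (lam (Fin.last m) - lam i.castSucc) := fun i => by
    rw [Fin.prod_univ_castSucc]
    simp [Fin.castSucc_lt_last]
  have h2 : (∏ j, if Fin.last m < j then lam j - lam (Fin.last m) else 1) = 1 :=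
    Finset.prod_eq_one fun j _ => if_neg (not_lt.2 (Fin.le_last j))
  rw [h2, mul_one]
  simp_rw [h1]
  rw [Finset.prod_mul_distrib]

/-- `M^(m - i)` depends only on the data of the `i` innermost steps. -/
theorem stage_congr {n m m' : ℕ} (mL : ℕ) (p : Params n m) (q : Params n m')
    (h0 : p.2.2.2 = q.2.2.2)
    (h1 : ∀ i hi hi', p.1 ⟨i, hi⟩ = q.1 ⟨i, hi'⟩)
    (h2 : ∀ i hi hi', (p.2.1 ⟨i, hi⟩ : Sphere (n + i)) = q.2.1 ⟨i, hi'⟩)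
    (h3 : ∀ i hi hi', (p.2.2.1 ⟨i, hi⟩ : Fin (n + i) → ℂ) = q.2.2.1 ⟨i, hi'⟩) :
    ∀ i h h', stage mL p i h = stage mL q i h'
  | 0, _, _ => h0
  | i + 1, h, h' => by
    rw [stage, stage, stage_congr mL p q h0 h1 h2 h3 i (Nat.le_of_succ_le h) (Nat.le_of_succ_le h')]
    split_ifs
    · exact congr (congr (congrArg₂ stepL (h1 i h h') (h2 i h h')) (h3 i h h')) rfl
    · exact congr (congr (congrArg₂ stepR (h1 i h h') (h2 i h h')) (h3 i h h')) rfl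

/-- Splitting off the last factor of a finite product preserves the product measures. -/
theorem measurePreserving_splitLast {m : ℕ} (α : Fin (m + 1) → Type) [∀ i, MeasureSpace (α i)]
    [∀ i, SigmaFinite (volume : Measure (α i))] :
    MeasurePreserving (fun f : (∀ i, α i) => ((fun j : Fin m => f j.castSucc), f (Fin.last m))) := by
  let e : (∀ j : Fin m, α j.castSucc) × α (Fin.last m) → ∀ i, α i := fun q => Fin.snoc q.1 q.2
  have he : Measurable e := by
    refine measurable_pi_lambda _ fun i => ?_
    refine Fin.lastCases ?_ (fun j => ?_) i
    · simp only [e, Fin.snoc_last]; exact measurable_snd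
    · simp only [e, Fin.snoc_castSucc]; exact (measurable_pi_apply j).comp measurable_fst
  have hmap : Measure.map e volume = volume := by
    symm
    refine Measure.pi_eq fun s hs => ?_
    rw [Measure.map_apply he (MeasurableSet.univ_pi hs)]
    have : e ⁻¹' Set.univ.pi s =
        (Set.univ.pi fun j : Fin m => s j.castSucc) ×ˢ s (Fin.last m) := by
      ext q
      simp only [Set.mem_preimage, Set.mem_univ_pi, Set.mem_prod, Fin.forall_fin_succ', e,
        Fin.snoc_castSucc, Fin.snoc_last]
    rw [this, Measure.volume_eq_prod, Measure.prod_prod, volume_pi, Measure.pi_pi,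
      Fin.prod_univ_castSucc]
  have hf : Measurable (fun f : (∀ i, α i) => ((fun j : Fin m => f j.castSucc), f (Fin.last m))) := by
    fun_prop
  refine ⟨hf, ?_⟩
  rw [← hmap, Measure.map_map hf he]
  convert Measure.map_id
  funext q
  simp [e]

/-- Exchanging the two middle factors of a fourfold product. -/
theorem measurePreserving_prod_prodComm {A B C D : Type} [MeasureSpace A] [MeasureSpace B]
    [MeasureSpace C] [MeasureSpace D] [SFinite (volume : Measure A)] [SFinite (volume : Measure B)]
    [SFinite (volume : Measure C)] [SFinite (volume : Measure D)] :
    MeasurePreserving (fun p : (A × B) × (C × D) => ((p.1.1, p.2.1), (p.1.2, p.2.2))) := by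
  have h1 : MeasurePreserving (MeasurableEquiv.prodAssoc : (A × B) × (C × D) ≃ᵐ A × (B × (C × D))) :=
    volume_preserving_prodAssoc
  have h2 : MeasurePreserving (MeasurableEquiv.prodAssoc : (A × C) × (B × D) ≃ᵐ A × (C × (B × D))) :=
    volume_preserving_prodAssoc
  have h3 : MeasurePreserving (Prod.map id (fun p : B × (C × D) => (p.2.1, (p.1, p.2.2))) :
      A × (B × (C × D)) → A × (C × (B × D))) :=
    (MeasurePreserving.id volume).prod measurePreserving_prod_leftComm
  exact ((h2.symm _).comp h3).comp h1

theorem measurePreserving_regroup {L L' U U' W W' M : Type} [MeasureSpace L] [MeasureSpace L']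
    [MeasureSpace U] [MeasureSpace U'] [MeasureSpace W] [MeasureSpace W'] [MeasureSpace M]
    [SFinite (volume : Measure L)] [SFinite (volume : Measure L')]
    [SFinite (volume : Measure U)] [SFinite (volume : Measure U')]
    [SFinite (volume : Measure W)] [SFinite (volume : Measure W')]
    [SFinite (volume : Measure M)] :
    MeasurePreserving (fun p : (L × L') × (U × U') × (W × W') × M =>
      ((p.1.1, p.2.1.1, p.2.2.1.1, p.2.2.2), (p.2.1.2, p.1.2, p.2.2.1.2))) := by
  have h1 : MeasurePreserving (fun p : (W × W') × M => ((p.1.1, p.2), p.1.2)) := by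
    have ha : MeasurePreserving (MeasurableEquiv.prodAssoc : (W × W') × M ≃ᵐ W × (W' × M)) :=
      volume_preserving_prodAssoc
    have hb : MeasurePreserving (MeasurableEquiv.prodAssoc : (W × M) × W' ≃ᵐ W × (M × W')) :=
      volume_preserving_prodAssoc
    have hc : MeasurePreserving (Prod.map id Prod.swap : W × (W' × M) → W × (M × W')) :=
      (MeasurePreserving.id volume).prod Measure.measurePreserving_swap
    exact ((hb.symm _).comp hc).comp ha
  have h2 : MeasurePreserving (fun p : (U × U') × (W × W') × M =>
      ((p.1.1, p.2.1.1, p.2.2), (p.1.2, p.2.1.2))) :=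
    measurePreserving_prod_prodComm.comp ((MeasurePreserving.id (volume : Measure (U × U'))).prod h1)
  have h3 : MeasurePreserving (fun p : (L × L') × (U × U') × (W × W') × M =>
      ((p.1.1, p.2.1.1, p.2.2.1.1, p.2.2.2), (p.1.2, p.2.1.2, p.2.2.1.2))) :=
    measurePreserving_prod_prodComm.comp ((MeasurePreserving.id (volume : Measure (L × L'))).prod h2)
  exact ((MeasurePreserving.id (volume : Measure (L × U × W × M))).prod
    (measurePreserving_prod_leftComm (A := L') (B := U') (C := W'))).comp h3

/-- The data of the innermost steps, together with those of the outermost one. -/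
theorem hasJac_splitParams (n m : ℕ) :
    HasJac (fun p : Params n (m + 1) =>
      ((((fun j => p.1 j.castSucc), (fun j => p.2.1 j.castSucc), (fun j => p.2.2.1 j.castSucc),
        p.2.2.2), (p.2.1 (Fin.last m), p.1 (Fin.last m), p.2.2.1 (Fin.last m))) :
        Params n m × Sphere (n + m) × ℂ × (Fin (n + m) → ℂ))) (fun _ => 1) := by
  have hL := measurePreserving_splitLast (m := m) (fun _ => ℂ)
  have hU := measurePreserving_splitLast (m := m) (fun i => Sphere (n + i))
  have hW := measurePreserving_splitLast (m := m) (fun i => Fin (n + i) → ℂ)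
  have h := (measurePreserving_regroup (M := Matrix (Fin n) (Fin n) ℂ)).comp
    (hL.prod (hU.prod (hW.prod (MeasurePreserving.id volume))))
  refine HasJac.of_measurePreserving
    (f' := fun q : Params n m × Sphere (n + m) × ℂ × (Fin (n + m) → ℂ) =>
      ((Fin.snoc q.1.1 q.2.2.1, Fin.snoc q.1.2.1 q.2.1, Fin.snoc q.1.2.2.1 q.2.2.2,
        q.1.2.2.2) : Params n (m + 1))) ?_ ?_ ?_ h
  · rintro ⟨l, u, w, M⟩
    refine Prod.ext ?_ (Prod.ext ?_ (Prod.ext ?_ rfl))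
    · exact Fin.snoc_init_self l
    · exact Fin.snoc_init_self u
    · exact Fin.snoc_init_self w
  · rintro ⟨⟨l, u, w, M⟩, u', l', w'⟩
    simp
  · have hsnoc : ∀ (α : Fin (m + 1) → Type) [∀ i, MeasurableSpace (α i)],
        Measurable fun q : (∀ j : Fin m, α j.castSucc) × α (Fin.last m) =>
          (Fin.snoc q.1 q.2 : ∀ i, α i) := by
      intro α _
      refine measurable_pi_lambda _ fun i => ?_
      refine Fin.lastCases ?_ (fun j => ?_) i
      · simp only [Fin.snoc_last]; exact measurable_snd
      · simp only [Fin.snoc_castSucc]; exact (measurable_pi_apply j).comp measurable_fst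
    have h1 := hsnoc (fun _ => ℂ)
    have h2 := hsnoc (fun i => Sphere (n + i))
    have h3 := hsnoc (fun i => Fin (n + i) → ℂ)
    exact (h1.comp (measurable_fst.fst.prodMk measurable_snd.snd.fst)).prodMk
      ((h2.comp (measurable_fst.snd.fst.prodMk measurable_snd.fst)).prodMk
        ((h3.comp (measurable_fst.snd.snd.fst.prodMk measurable_snd.snd.snd)).prodMk
          measurable_fst.snd.snd.snd))

/-- The composition of all steps has the squared modulus of the Vandermonde product times the
characteristic polynomial of `M^(m)` at the eigenvalues as Jacobian. -/
theorem hasJac_stage (n mL m : ℕ) :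
    HasJac (fun p : Params n m => stage mL p m le_rfl)
      (fun p => ENNReal.ofReal (‖vandermondeProd p.1‖ ^ 2 *
        ∏ i, ‖(Matrix.scalar (Fin n) (p.1 i) - p.2.2.2).det‖ ^ 2)) := by
  induction m with
  | zero =>
    have hmp : MeasurePreserving (fun p : Params n 0 => p.2.2.2) := by
      have : ∀ (α : Fin 0 → Type) [∀ i, MeasureSpace (α i)],
          IsProbabilityMeasure (volume : Measure (∀ i, α i)) := fun α _ => by
        have : ∀ i, IsProbabilityMeasure (volume : Measure (α i)) := fun i => i.elim0
        rw [volume_pi]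
        infer_instance
      have h1 := this fun _ => ℂ
      have h2 := this fun i => Sphere (n + i)
      have h3 := this fun i => Fin (n + i) → ℂ
      exact (measurePreserving_snd.comp measurePreserving_snd).comp measurePreserving_snd
    have h : HasJac (fun p : Params n 0 => p.2.2.2) (fun _ => 1) := by
      refine HasJac.of_measurePreserving
        (f' := fun M => ((fun i => i.elim0), (fun i => i.elim0), (fun i => i.elim0), M)) ?_ ?_ ?_ hmp
      · rintro ⟨l, u, w, M⟩
        exact Prod.ext (Subsingleton.elim _ _)
          (Prod.ext (funext fun i => i.elim0) (Prod.ext (funext fun i => i.elim0) rfl))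
      · exact fun _ => rfl
      · exact measurable_const.prodMk (measurable_const.prodMk
          (measurable_const.prodMk measurable_id))
    refine HasJac.congr (f := fun p : Params n 0 => stage mL p 0 le_rfl) h fun p => ?_
    simp [vandermondeProd]
  | succ m ih =>
    have hstep : HasJac (fun p : Matrix (Fin (n + m)) (Fin (n + m)) ℂ ×
        (Sphere (n + m) × (ℂ × (Fin (n + m) → ℂ))) =>
        if m < mL then stepL p.2.2.1 p.2.1 p.2.2.2 p.1 else stepR p.2.2.1 p.2.1 p.2.2.2 p.1)
        (fun p => ENNReal.ofReal
          (‖(Matrix.scalar (Fin (n + m)) p.2.2.1 - p.1).det‖ ^ 2)) := by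
      by_cases hm : m < mL
      · simp only [hm, if_true]; exact hasJac_stepL _
      · simp only [hm, if_false]; exact hasJac_stepR _
    have h := hstep.comp ((ih.prodMap_id (Ω := Sphere (n + m) × (ℂ × (Fin (n + m) → ℂ)))
      fun _ => ENNReal.ofReal_ne_top).comp (hasJac_splitParams n m))
    have heq : (fun p : Params n (m + 1) => stage mL p (m + 1) le_rfl) =
        (fun p : Matrix (Fin (n + m)) (Fin (n + m)) ℂ ×
          (Sphere (n + m) × (ℂ × (Fin (n + m) → ℂ))) =>
          if m < mL then stepL p.2.2.1 p.2.1 p.2.2.2 p.1 else stepR p.2.2.1 p.2.1 p.2.2.2 p.1) ∘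
        Prod.map (fun p : Params n m => stage mL p m le_rfl) id ∘
        fun p : Params n (m + 1) =>
          ((((fun j => p.1 j.castSucc), (fun j => p.2.1 j.castSucc), (fun j => p.2.2.1 j.castSucc),
            p.2.2.2), (p.2.1 (Fin.last m), p.1 (Fin.last m), p.2.2.1 (Fin.last m))) :
            Params n m × Sphere (n + m) × ℂ × (Fin (n + m) → ℂ)) := by
      funext p
      rw [stage, stage_congr mL p ((fun j => p.1 j.castSucc), (fun j => p.2.1 j.castSucc),
        (fun j => p.2.2.1 j.castSucc), p.2.2.2) rfl (fun _ _ _ => rfl) (fun _ _ _ => rfl)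
        (fun _ _ _ => rfl) m (Nat.le_succ m) le_rfl]
      rfl
    rw [heq]
    refine h.congr fun p => ?_
    simp only [Function.comp, Prod.map, id, mul_one]
    rw [det_scalar_sub_stage, ← ENNReal.ofReal_mul (by positivity), vandermondeProd_succ,
      Fin.prod_univ_castSucc]
    congr 1
    have hc : ∀ j : Fin m, j.castLE le_rfl = j := fun _ => rfl
    simp only [hc, norm_mul, mul_pow]
    ring

/-- The change of variables formula in terms of real-valued Jacobians. -/
theorem HasJac.isJacobian {X Y : Type*} [MeasureSpace X] [MeasureSpace Y] {f : X → Y}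
    {J : X → ℝ} (h : HasJac f fun x => ENNReal.ofReal (J x)) (h0 : ∀ x, 0 ≤ J x) :
    IsJacobian f J := by
  refine ⟨h0, ?_, h.lintegral_eq⟩
  have := h.measurable_jac.ennreal_toReal
  simpa only [ENNReal.toReal_ofReal (h0 _)] using this

end EigenvectorChange

end

theorem lemma3p1 (n mR mL : ℕ) :
    EigenvectorChange.IsJacobian (EigenvectorChange.Phi n mR mL)
      (fun p => ‖EigenvectorChange.vandermondeProd p.1‖ ^ 2 *
        ∏ i, ‖(Matrix.scalar (Fin n) (p.1 i) - p.2.2.2).det‖ ^ 2) := by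
  exact (EigenvectorChange.hasJac_stage n mL (mR + mL)).isJacobian fun p => by positivity
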